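/- **Setting.** Let $n,\kappa,\lambda\ge 0$ be integers, $\mu=(\mu_1,\dots,\mu_\lambda)$, $x=(x_1,\dots,x_n)$, $u=(u_1,\dots,u_\kappa)$, and let $$\Sigma:\qquad x'=f(x,\mu,u),\qquad y=g(x,\mu,u),\qquad x(0)=x^*,$$ be a system with exactly one output $y$, where $f=(f_1,\dots,f_n)$ and $g$ are polynomials of degree at most one in $x,u$ over $\mathbb C(\mu)$. **Identifiability.** Let $\mathbb C^\infty(0)$ be the set of functions complex analytic in some neighborhood of $t=0$ (considered as germs at $0$). Let $\Omega\subset\mathbb C^\lambda$ be the set of points at which no denominator (in lowest terms) of a coefficient of $f,g$ vanishes, and for $h\in\mathbb C(\mu)$ let $\Omega_h=\mathbb C^n\times\{\hat\mu\in\Omega\mid h(\hat\mu)\text{ is well-defined}\}\times\mathbb C^\infty(0)^\kappa$. For $\hat x\in\mathbb C^n$, $\hat\mu\in\Omega$, $\hat u\in\mathbb C^\infty(0)^\kappa$ let $Y(\hat x,\hat\mu,\hat u)\in\mathbb C^\infty(0)$ be the output of $\Sigma$ with $x^*=\hat x$, $\mu=\hat\mu$, $u=\hat u$. Put $$S_h(\hat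 x,\hat\mu,\hat u)=\{h(\tilde\mu)\mid (\tilde x,\tilde\mu,\hat u)\in\Omega_h\text{ for some }\tilde x \text{ with } Y(\hat x,\hat\mu,\hat u)=Y(\tilde x,\tilde\mu,\hat u)\}.$$ Then $h$ is *identifiable* if there are a nonempty set $\Theta\subset\mathbb C^n\times\mathbb C^\lambda$ that is the complement of the zero set of a polynomial, and a nonempty set $U\subset\mathbb C^\infty(0)^\kappa$ of the form $\{z\mid P(z)|_{t=0}\neq0\}$ with $P$ a complex polynomial in $z_1,\dots,z_\kappa$ and their derivatives, such that $|S_h(\hat x,\hat\mu,\hat u)|=1$ for all $(\hat x,\hat\mu,\hat u)\in(\Theta\times U)\cap\Omega_h$. **IO-identifiability.** Let $\mathbb C(\mu)\{x,y,u\}$ be the ring of polynomials over $\mathbb C(\mu)$ in $x_i,y,u_k$ and all their formal derivatives, with the derivation that vanishes on $\mathbb C(\mu)$, and let $I_\Sigma$ be the smallest ideal that is closed under the derivation and contains $x_i'-f_i$ ($1\le i\le n$) and $y-g$. The *input-output equation* of $\Sigma$ is the element $p\in I_\Sigma\cap\mathbb C(\mu)\{y,u\}$ of total degree at most one, in which $y$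 or one of its derivatives appears and the highest derivative of $y$ has coefficient one, of the smallest possible order in $y$. A function $h\in\mathbb C(\mu)$ is *IO-identifiable* if it lies in the subfield of $\mathbb C(\mu)$ generated over $\mathbb C$ by the coefficients of $p$. **Theorem.** For every such $\Sigma$ and every $h\in\mathbb C(\mu)$, $$h\text{ is identifiable}\iff h\text{ is IO-identifiable}.$$ Equivalently, the set of identifiable functions is the subfield of $\mathbb C(\mu)$ generated over $\mathbb C$ by the coefficients of the input-output equation. -/

import Mathlib

open scoped Topology

noncomputable section

namespace LinearIdent

/-! ### Rational functions of the parameters -/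

/-- The field `ℂ(μ₁, …, μ_l)` of rational functions of the parameters. -/
abbrev ParamField (l : ℕ) : Type := FractionRing (MvPolynomial (Fin l) ℂ)

/-- `h(μ)` is well-defined: the denominator of `h`, written in lowest terms, does not vanish
at `μ`. -/
def DefinedAt {l : ℕ} (h : ParamField l) (μ : Fin l → ℂ) : Prop :=
  MvPolynomial.eval μ (IsFractionRing.den (MvPolynomial (Fin l) ℂ) h : MvPolynomial (Fin l) ℂ) ≠ 0

/-- The value `h(μ)` (meaningful when `DefinedAt h μ`). -/
def ratEval {l : ℕ} (h : ParamField l) (μ : Fin l → ℂ) : ℂ :=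
  MvPolynomial.eval μ (IsFractionRing.num (MvPolynomial (Fin l) ℂ) h) /
    MvPolynomial.eval μ (IsFractionRing.den (MvPolynomial (Fin l) ℂ) h : MvPolynomial (Fin l) ℂ)

/-- Specialize the parameters in the coefficients of a polynomial over `ℂ(μ)` to the complex
numbers `μ`, and its variables to the complex numbers `z`. -/
def evalAt {l : ℕ} {V : Type} (F : MvPolynomial V (ParamField l)) (μ : Fin l → ℂ) (z : V → ℂ) :
    ℂ :=
  ∑ e ∈ F.support, ratEval (F.coeff e) μ * e.prod fun v k => z v ^ k

/-! ### The ODE systems -/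

/-- A linear system `x' = f(x, μ, u)`, `y = g(x, μ, u)` with `n` states, `m` outputs, `κ` inputs
and `l` parameters: the entries of `f` and `g` are polynomials of degree at most one in the states
(`Sum.inl`) and the inputs (`Sum.inr`) over `ℂ(μ)`. -/
structure LinearSystem (n m κ l : ℕ) where
  f : Fin n → MvPolynomial (Fin n ⊕ Fin κ) (ParamField l)
  g : Fin m → MvPolynomial (Fin n ⊕ Fin κ) (ParamField l)
  degree_f : ∀ i, (f i).totalDegree ≤ 1
  degree_g : ∀ j, (g j).totalDegree ≤ 1

/-! ### Identifiability -/

/-- Functions that are complex analytic in some neighborhood of `t = 0`. They matter only as germs: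
all the notions below depend only on the values near `0`. -/
abbrev AnalyticFn : Type := {φ : ℂ → ℂ // AnalyticAt ℂ φ 0}

/-- Nonempty Zariski open subsets of `ℂⁿ × ℂˡ`: nonempty complements of the zero set of one
polynomial. -/
def IsNonemptyZariskiOpen {n l : ℕ} (Θ : Set ((Fin n → ℂ) × (Fin l → ℂ))) : Prop :=
  Θ.Nonempty ∧ ∃ P : MvPolynomial (Fin n ⊕ Fin l) ℂ,
    Θ = {z | MvPolynomial.eval (Sum.elim z.1 z.2) P ≠ 0}

/-- Nonempty Zariski open sets of `κ`-tuples of analytic functions: nonempty sets of the form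
`{z | P(z)|_{t = 0} ≠ 0}`, with `P` a polynomial in `z₁, …, z_κ` and their derivatives; the
variable `(j, i)` of `P` stands for the `i`-th derivative of `z_j`. -/
def IsNonemptyZariskiOpenFn {κ : ℕ} (U : Set (Fin κ → AnalyticFn)) : Prop :=
  U.Nonempty ∧ ∃ P : MvPolynomial (Fin κ × ℕ) ℂ,
    U = {z | MvPolynomial.eval (fun a : Fin κ × ℕ => iteratedDeriv a.2 (z a.1).1 0) P ≠ 0}

namespace LinearSystem

variable {n m κ l : ℕ} (S : LinearSystem n m κ l)

/-- The set `Ω` of parameter values at which no denominator of a coefficient of the system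
vanishes. -/
def Ω : Set (Fin l → ℂ) :=
  {μ | (∀ i e, DefinedAt ((S.f i).coeff e) μ) ∧ ∀ j e, DefinedAt ((S.g j).coeff e) μ}

/-- The set `Ω_h = ℂⁿ × {μ ∈ Ω | h(μ) is well-defined} × (analytic functions)^κ`. -/
def ΩOf (h : ParamField l) : Set ((Fin n → ℂ) × (Fin l → ℂ) × (Fin κ → AnalyticFn)) :=
  {w | w.2.1 ∈ S.Ω ∧ DefinedAt h w.2.1}

/-- `X` is the solution of `x' = f(x, μ, u)`, `x(0) = x₀`, near `t = 0`. -/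
def IsStateSolution (x₀ : Fin n → ℂ) (μ : Fin l → ℂ) (u : Fin κ → AnalyticFn)
    (X : Fin n → AnalyticFn) : Prop :=
  (∀ i, (X i).1 0 = x₀ i) ∧
  ∀ i, ∀ᶠ t in 𝓝 (0 : ℂ), HasDerivAt (X i).1
    (evalAt (S.f i) μ (Sum.elim (fun j => (X j).1 t) fun k => (u k).1 t)) t

/-- `Y` is, as a tuple of germs at `0`, the output `Y(x₀, μ, u)` of the system for the initial
value `x₀`, the parameter values `μ` and the input `u`. -/
def IsOutput (x₀ : Fin n → ℂ) (μ : Fin l → ℂ) (u : Fin κ → AnalyticFn)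
    (Y : Fin m → AnalyticFn) : Prop :=
  ∃ X : Fin n → AnalyticFn, S.IsStateSolution x₀ μ u X ∧
    ∀ j, ∀ᶠ t in 𝓝 (0 : ℂ), (Y j).1 t =
      evalAt (S.g j) μ (Sum.elim (fun i => (X i).1 t) fun k => (u k).1 t)

/-- `S_h(x₀, μ, u)`: the values of `h` at all parameter values that can produce, for some initial
value and for the same input `u`, the output `Y(x₀, μ, u)`. -/
def outputFiber (h : ParamField l) (x₀ : Fin n → ℂ) (μ : Fin l → ℂ)
    (u : Fin κ → AnalyticFn) : Set ℂ :=
  {c | ∃ (x₁ : Fin n → ℂ) (ν : Fin l → ℂ), (x₁, ν, u) ∈ S.ΩOf h ∧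
    (∃ Y, S.IsOutput x₀ μ u Y ∧ S.IsOutput x₁ ν u Y) ∧ c = ratEval h ν}

/-- `h ∈ ℂ(μ)` is identifiable. -/
def Identifiable (h : ParamField l) : Prop :=
  ∃ Θ : Set ((Fin n → ℂ) × (Fin l → ℂ)), IsNonemptyZariskiOpen Θ ∧
  ∃ U : Set (Fin κ → AnalyticFn), IsNonemptyZariskiOpenFn U ∧
  ∀ x₀ μ u, (x₀, μ) ∈ Θ → u ∈ U → (x₀, μ, u) ∈ S.ΩOf h → (S.outputFiber h x₀ μ u).encard = 1

end LinearSystem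

/-! ### Differential polynomials -/

/-- The ring `K{V}` of differential polynomials over a field `K` of constants, in the differential
variables `V`; the variable `(v, i)` stands for the `i`-th derivative of `v`. -/
abbrev DiffPoly (K V : Type) [Field K] : Type := MvPolynomial (V × ℕ) K

/-- The derivation of `K{V}`: it kills `K` and sends `v⁽ⁱ⁾` to `v⁽ⁱ⁺¹⁾`. -/
def diffDeriv (K V : Type) [Field K] : Derivation K (DiffPoly K V) (DiffPoly K V) :=
  MvPolynomial.mkDerivation K fun a : V × ℕ => MvPolynomial.X (a.1, a.2 + 1)

/-- The smallest differential ideal `[F]` of `K{V}` that contains the set `F`. -/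
def diffIdeal {K V : Type} [Field K] (F : Set (DiffPoly K V)) : Ideal (DiffPoly K V) :=
  sInf {I | F ⊆ I ∧ ∀ a ∈ I, diffDeriv K V a ∈ I}

open Classical in
/-- The order of `P` with respect to `v`: the order of the highest derivative of `v` that appears
in `P`, and `-∞ = ⊥` if there is none. -/
def diffOrd {K V : Type} [Field K] (v : V) (P : DiffPoly K V) : WithBot ℕ :=
  (P.vars.filter fun a => a.1 = v).sup fun a => (a.2 : WithBot ℕ)

/-! ### Input-output equations and IO-identifiability -/

namespace LinearSystem

variable {n m κ l : ℕ} (S : LinearSystem n m κ l)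

/-- A polynomial in `x, u` as a differential polynomial (of order zero) in `x, y, u`. -/
def toDiff (F : MvPolynomial (Fin n ⊕ Fin κ) (ParamField l)) :
    DiffPoly (ParamField l) (Fin n ⊕ Fin m ⊕ Fin κ) :=
  MvPolynomial.rename (Sum.elim (fun i => (Sum.inl i, 0)) fun k => (Sum.inr (Sum.inr k), 0)) F

/-- The differential ideal `I_Σ = [x' - f, y - g]` of `ℂ(μ){x, y, u}`. -/
def ideal : Ideal (DiffPoly (ParamField l) (Fin n ⊕ Fin m ⊕ Fin κ)) :=
  diffIdeal
    ((Set.range fun i : Fin n => MvPolynomial.X (Sum.inl i, 1) - toDiff (S.f i)) ∪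
      Set.range fun j : Fin m => MvPolynomial.X (Sum.inr (Sum.inl j), 0) - toDiff (S.g j))

/-- The inclusion of `ℂ(μ){y, u}` in `ℂ(μ){x, y, u}`. -/
def inclYU (p : DiffPoly (ParamField l) (Fin m ⊕ Fin κ)) :
    DiffPoly (ParamField l) (Fin n ⊕ Fin m ⊕ Fin κ) :=
  MvPolynomial.rename (fun a => (Sum.inr a.1, a.2)) p

/-- The conditions on the entry `q` of a full set of input-output equations that belongs to the
output `y_j`, apart from the minimality of its order. The outputs are ordered by
`y_i < y_j ↔ σ i < σ j`, and `p i` is the equation that belongs to `y_i`. The conditions are that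
`q` is a linear differential polynomial (possibly with a constant term) in `u`, in `y_j` and in the
smaller outputs, that it lies in `I_Σ`, that its order in every smaller `y_i` is less than that of
`p i`, and that the coefficient of the highest derivative of `y_j` is one. -/
def IsIOCandidate (σ : Equiv.Perm (Fin m)) (p : Fin m → DiffPoly (ParamField l) (Fin m ⊕ Fin κ))
    (j : Fin m) (q : DiffPoly (ParamField l) (Fin m ⊕ Fin κ)) : Prop :=
  inclYU q ∈ S.ideal ∧ q.totalDegree ≤ 1 ∧
  (∀ i, σ j < σ i → diffOrd (Sum.inl i) q = ⊥) ∧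
  (∀ i, σ i < σ j → diffOrd (Sum.inl i) q < diffOrd (Sum.inl i) (p i)) ∧
  ∃ r : ℕ, diffOrd (Sum.inl j) q = r ∧ q.coeff (Finsupp.single (Sum.inl j, r) 1) = 1

/-- `p` is a full set of input-output equations: for some ordering of the outputs, every `p j`
satisfies the conditions above, and its order in `y_j` is the smallest possible. -/
def IsFullIOSet (p : Fin m → DiffPoly (ParamField l) (Fin m ⊕ Fin κ)) : Prop :=
  ∃ σ : Equiv.Perm (Fin m), ∀ j, S.IsIOCandidate σ p j (p j) ∧
    ∀ q, S.IsIOCandidate σ p j q → diffOrd (Sum.inl j) (p j) ≤ diffOrd (Sum.inl j) q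

end LinearSystem

/-- The subfield of `ℂ(μ)` generated over `ℂ` by the coefficients of the differential polynomials
`p`. -/
def coeffField {m κ l : ℕ} (p : Fin m → DiffPoly (ParamField l) (Fin m ⊕ Fin κ)) :
    IntermediateField ℂ (ParamField l) :=
  IntermediateField.adjoin ℂ {c | ∃ j e, c = (p j).coeff e}

/-- `h ∈ ℂ(μ)` is IO-identifiable: it lies in the field generated over `ℂ` by the coefficients of
a full set of input-output equations. -/
def LinearSystem.IOIdentifiable {n m κ l : ℕ} (S : LinearSystem n m κ l) (h : ParamField l) :
    Prop :=
  ∃ p, S.IsFullIOSet p ∧ h ∈ coeffField p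

end LinearIdent

end

/-!
For given values of the parameters the system has constant coefficients, so that everything can be
read off from the sequences of the derivatives at `0`, on which `d/dt` acts as a shift. Constant
terms of `f` and `g` are treated as the coefficients of an additional input, the function `1`. The
system is then `x' = A x + B w`, `y = C x + D w`, and every polynomial `e` satisfies
`e(d/dt) y = C e(A) x + ∑ resp(e)(d/dt) w` along solutions (`StateSpace.IsTraj.op_out`).

Let `a` be the monic generator of the annihilator `{e | C e(A) = 0}` over `ℂ(μ)`. The input-output
equation is the relation `a(d/dt) y = ∑ resp(a)(d/dt) w` (`LinearSystem.isFullIOSet_iff`): the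
relation lies in the differential ideal, as the variables form a trajectory modulo the ideal, and
reduction to a normal form in which only states and inputs occur shows that there are no other
relations of degree one. As `a` divides the characteristic polynomial of `A` and the local ring of a
point of `Ω` is integrally closed, the input-output equation can be specialized at *every* point of
`Ω` (`LinearSystem.exists_specialized_annihilator`).

If `h` lies in the field generated by the coefficients, it is enough that a generic output
determines the specialized input-output equation. Two such equations with a common solution have a
difference of lower order in `y`. For an input that satisfies no linear differential equation of
order at most `2n`, such an equation forces conditions on the initial state, which are
excluded if a Hankel matrix of the free response is nonsingular
(`StateSpace.io_equation_unique`). The constant solutions of the equation, which occur if `X ∣ a`,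
require that only the part of `a` prime to `X` enters the matrix. Over `ℂ(μ)`, the matrix is
nonsingular for a suitable initial state (`StateSpace.exists_det_hankel_ne_zero`), hence it is
nonsingular for generic initial states and parameters.

If `h` does not lie in this field, there are two embeddings of `ℂ(μ)` in some field that agree on
the coefficients but not on `h`. By the Nullstellensatz there are two generic points of `Ω` at which
the coefficients agree but `h` does not (`exists_points_of_notMem_adjoin`). At these points the
system has the same input-output equation, and for a suitable initial state the system at the second
point has the output of the system at the first one (`StateSpace.exists_outSeq_eq`), so that `h` is
not identifiable.
-/

noncomputable section

namespace LinearIdent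
open Polynomial Matrix

/-! ### Sequences and the shift operator -/

section Shift

variable {R M : Type*} [CommRing R] [AddCommGroup M] [Module R M]

/-- The shift `(w₀, w₁, …) ↦ (w₁, w₂, …)` of sequences; on the sequence of the derivatives of a
function at a point it is differentiation. -/
def shift (R M : Type*) [CommRing R] [AddCommGroup M] [Module R M] : Module.End R (ℕ → M) where
  toFun w j := w (j + 1)
  map_add' _ _ := rfl
  map_smul' _ _ := rfl

/-- The action of a polynomial in the shift, that is, of a linear differential operator with
constant coefficients. -/
def op (f : R[X]) : (ℕ → M) →ₗ[R] (ℕ → M) := aeval (shift R M) f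

@[simp] lemma shift_apply (w : ℕ → M) (j : ℕ) : shift R M w j = w (j + 1) := rfl

lemma op_add (f g : R[X]) (w : ℕ → M) : op (f + g) w = op f w + op g w := by simp [op]

lemma op_add_apply (f g : R[X]) (w : ℕ → M) (j : ℕ) : op (f + g) w j = op f w j + op g w j := by
  rw [op_add, Pi.add_apply]

lemma op_sub (f g : R[X]) (w : ℕ → M) : op (f - g) w = op f w - op g w := by simp [op]

lemma op_mul (f g : R[X]) (w : ℕ → M) : op (f * g) w = op f (op g w) := by simp [op]

@[simp] lemma op_zero (w : ℕ → M) : op (0 : R[X]) w = 0 := by simp [op]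

@[simp] lemma op_C (c : R) (w : ℕ → M) : op (C c) w = c • w := by
  simp [op, Module.algebraMap_end_apply]

lemma op_smul (c : R) (f : R[X]) (w : ℕ → M) : op (c • f) w = c • op f w := by simp [op]

lemma op_X_mul (f : R[X]) (w : ℕ → M) (j : ℕ) : op (X * f) w j = op f w (j + 1) := by
  simp [op]

lemma shift_pow_apply (i : ℕ) (w : ℕ → M) (j : ℕ) : (shift R M ^ i) w j = w (i + j) := by
  induction i generalizing j with
  | zero => simp
  | succ i ih => rw [pow_succ', Module.End.mul_apply, shift_apply, ih]; congr 1; omega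

lemma op_monomial (i : ℕ) (c : R) (w : ℕ → M) (j : ℕ) :
    op (monomial i c) w j = c • w (i + j) := by
  simp [op, aeval_monomial, Module.algebraMap_end_apply, shift_pow_apply]

lemma op_apply (f : R[X]) (w : ℕ → M) (j : ℕ) :
    op f w j = f.sum fun i c => c • w (i + j) := by
  induction f using Polynomial.induction_on' with
  | add p q hp hq =>
    rw [op_add, Pi.add_apply, hp, hq, sum_add_index] <;> simp [add_smul]
  | monomial i c => rw [op_monomial, sum_monomial_index]; simp

/-- The sequence of the derivatives of the constant function `1`. -/
def unitSeq (R : Type*) [Zero R] [One R] : ℕ → R := Pi.single 0 1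

lemma op_unitSeq {R : Type*} [CommRing R] (f : R[X]) :
    op f (unitSeq R) = f.coeff 0 • unitSeq R := by
  induction f using Polynomial.induction_on' with
  | add p q hp hq => rw [op_add, hp, hq, coeff_add, add_smul]
  | monomial i c =>
    ext j
    rw [op_monomial]
    rcases i with _ | i
    · simp
    · simp [unitSeq, coeff_monomial]

end Shift

/-! ### State space systems over a ring -/

/-- The coefficients of the system `x' = A x + B w`, `y = C x + D w` with one output. -/
structure StateSpace (R ι J : Type*) where
  A : Matrix ι ι R
  B : Matrix ι J R
  C : ι → R
  D : J → R

namespace StateSpace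

variable {R R' ι J : Type*} [CommRing R] [CommRing R'] [Fintype ι] [DecidableEq ι]
  (𝒮 : StateSpace R ι J)

/-- The row vector `C e(A)`. -/
def obs (e : R[X]) : ι → R := 𝒮.C ᵥ* aeval 𝒮.A e

/-- The operator by which the input `w k` enters the `i`-th derivative of the output. -/
def tau (k : J) : ℕ → R[X]
  | 0 => Polynomial.C (𝒮.D k)
  | i + 1 => X * tau k i + Polynomial.C (𝒮.obs (X ^ i) ⬝ᵥ fun v => 𝒮.B v k)

/-- The operator by which the input `w k` enters `e(d/dt) y`, when the derivatives of the states
are eliminated by means of the state equations; see `IsTraj.op_out`. -/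
def resp (k : J) : R[X] →ₗ[R] R[X] :=
  Polynomial.lsum fun i => LinearMap.toSpanSingleton R R[X] (𝒮.tau k i)

lemma resp_apply (k : J) (e : R[X]) : 𝒮.resp k e = e.sum fun i c => c • 𝒮.tau k i := rfl

@[simp] lemma resp_monomial (k : J) (i : ℕ) (c : R) :
    𝒮.resp k (monomial i c) = c • 𝒮.tau k i := by
  rw [resp_apply, sum_monomial_index]; simp

lemma obs_add (e f : R[X]) : 𝒮.obs (e + f) = 𝒮.obs e + 𝒮.obs f := by
  simp [obs, vecMul_add]

lemma obs_mul (e f : R[X]) : 𝒮.obs (e * f) = 𝒮.obs e ᵥ* aeval 𝒮.A f := by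
  simp [obs, vecMul_vecMul]

lemma obs_mul_X (e : R[X]) : 𝒮.obs (e * X) = 𝒮.obs e ᵥ* 𝒮.A := by
  simp [obs_mul]

lemma obs_smul (c : R) (e : R[X]) : 𝒮.obs (c • e) = c • 𝒮.obs e := by
  simp [obs, vecMul_smul]

lemma obs_monomial (i : ℕ) (c : R) : 𝒮.obs (monomial i c) = c • 𝒮.obs (X ^ i) := by
  rw [← obs_smul, smul_X_eq_monomial]

lemma obs_charpoly : 𝒮.obs 𝒮.A.charpoly = 0 := by
  rw [obs, Matrix.aeval_self_charpoly, vecMul_zero]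

lemma obs_eq_sum (e : R[X]) {N : ℕ} (h : e.natDegree < N) :
    𝒮.obs e = ∑ i ∈ Finset.range N, e.coeff i • 𝒮.obs (X ^ i) := by
  conv_lhs => rw [e.as_sum_range' N h]
  have hadd : ∀ s : Finset ℕ, 𝒮.obs (∑ i ∈ s, monomial i (e.coeff i)) =
      ∑ i ∈ s, 𝒮.obs (monomial i (e.coeff i)) := fun s =>
    map_sum (AddMonoidHom.mk' 𝒮.obs 𝒮.obs_add) _ _
  rw [hadd]
  simp_rw [obs_monomial]

lemma natDegree_tau_le (k : J) (i : ℕ) : (𝒮.tau k i).natDegree ≤ i := by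
  induction i with
  | zero => simp [tau]
  | succ i ih =>
    rw [tau]
    refine (natDegree_add_le _ _).trans (max_le ?_ (by simp))
    exact natDegree_mul_le.trans (by have := natDegree_X_le (R := R); omega)

lemma natDegree_resp_le (k : J) (e : R[X]) : (𝒮.resp k e).natDegree ≤ e.natDegree := by
  rw [resp_apply, Polynomial.sum]
  refine natDegree_sum_le_of_forall_le _ _ fun i hi => ?_
  exact (natDegree_smul_le _ _).trans ((𝒮.natDegree_tau_le k i).trans (le_natDegree_of_mem_supp i hi))

/-- Without direct feedthrough, the input enters with lower order than the output. -/
lemma degree_resp_lt (hD : 𝒮.D = 0) (k : J) {e : R[X]} (he : e ≠ 0) :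
    (𝒮.resp k e).degree < e.degree := by
  have htau : ∀ i, (𝒮.tau k i).degree < (i : WithBot ℕ) := by
    intro i
    rw [degree_lt_iff_coeff_zero]
    induction i with
    | zero => simp [tau, hD]
    | succ i ih =>
      intro m hm
      obtain ⟨m, rfl⟩ : ∃ m', m = m' + 1 := ⟨m - 1, by omega⟩
      rw [tau, coeff_add, coeff_X_mul, ih m (by omega), coeff_C_succ, add_zero]
  rw [resp_apply, Polynomial.sum]
  refine (degree_sum_le _ _).trans_lt ?_
  rw [Finset.sup_lt_iff (by rw [bot_lt_iff_ne_bot]; simpa using he)]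
  intro i hi
  refine (degree_smul_le _ _).trans_lt ((htau i).trans_le ?_)
  exact le_degree_of_mem_supp i hi

/-- The image of a system under a ring homomorphism of the coefficients. -/
@[simps] def map (φ : R →+* R') : StateSpace R' ι J where
  A := 𝒮.A.map φ
  B := 𝒮.B.map φ
  C := φ ∘ 𝒮.C
  D := φ ∘ 𝒮.D

lemma obs_map (φ : R →+* R') (e : R[X]) : (𝒮.map φ).obs (e.map φ) = φ ∘ 𝒮.obs e := by
  have hA : aeval (𝒮.A.map φ) (e.map φ) = (aeval 𝒮.A e).map φ := by
    induction e using Polynomial.induction_on' with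
    | add p q hp hq => rw [Polynomial.map_add, map_add, hp, hq, map_add, Matrix.map_add _ (map_add φ)]
    | monomial i c =>
      rw [map_monomial, aeval_monomial, aeval_monomial, ← Algebra.smul_def, ← Algebra.smul_def,
        Matrix.map_smul' _ _ _ (map_mul φ)]
      congr 1
      exact (Matrix.map_pow 𝒮.A φ i).symm
  ext v
  simp only [obs, map_A, map_C, hA, vecMul, dotProduct, Function.comp, map_sum, map_mul,
    Matrix.map_apply]

lemma tau_map (φ : R →+* R') (k : J) (i : ℕ) : (𝒮.map φ).tau k i = (𝒮.tau k i).map φ := by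
  induction i with
  | zero => simp [tau]
  | succ i ih =>
    have h := 𝒮.obs_map φ (X ^ i)
    rw [Polynomial.map_pow, Polynomial.map_X] at h
    rw [tau, tau, ih, h]
    simp [dotProduct, Polynomial.map_sum]

lemma resp_map (φ : R →+* R') (k : J) (e : R[X]) :
    (𝒮.map φ).resp k (e.map φ) = (𝒮.resp k e).map φ := by
  induction e using Polynomial.induction_on' with
  | add p q hp hq => rw [Polynomial.map_add, map_add, hp, hq, map_add, Polynomial.map_add]
  | monomial i c => rw [map_monomial, resp_monomial, resp_monomial, tau_map, Polynomial.map_smul]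

/-! ### Trajectories -/

variable {M : Type*} [AddCommGroup M] [Module R M] [Fintype J]

/-- The sequences `x`, `w`, `y` are the sequences of derivatives of the states, the inputs and the
output along a solution of the system, with values in any module over the coefficient ring. -/
structure IsTraj (x : ι → ℕ → M) (w : J → ℕ → M) (y : ℕ → M) : Prop where
  state : ∀ v j, x v (j + 1) = ∑ v', 𝒮.A v v' • x v' j + ∑ k, 𝒮.B v k • w k j
  out : ∀ j, y j = ∑ v, 𝒮.C v • x v j + ∑ k, 𝒮.D k • w k j

variable {𝒮}

/-- The derivatives of the output in terms of the states and the derivatives of the inputs. -/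
lemma IsTraj.out_add {x : ι → ℕ → M} {w : J → ℕ → M} {y : ℕ → M} (h : 𝒮.IsTraj x w y) (i j : ℕ) :
    y (i + j) = ∑ v, 𝒮.obs (X ^ i) v • x v j + ∑ k, op (𝒮.tau k i) (w k) j := by
  induction i generalizing j with
  | zero => simp [h.out, obs, tau]
  | succ i ih =>
    rw [add_assoc, add_comm 1 j, ih, pow_succ, obs_mul_X]
    simp only [h.state, tau, op_add, Pi.add_apply, op_X_mul, op_C, Pi.smul_apply, vecMul, dotProduct,
      smul_add, Finset.smul_sum, Finset.sum_smul, Finset.sum_add_distrib, smul_smul,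
      Finset.sum_apply]
    rw [Finset.sum_comm (s := Finset.univ (α := ι)) (t := Finset.univ (α := ι)),
      Finset.sum_comm (s := Finset.univ (α := ι)) (t := Finset.univ (α := J))]
    abel

/-- The effect of a differential operator on the output. -/
lemma IsTraj.op_out {x : ι → ℕ → M} {w : J → ℕ → M} {y : ℕ → M} (h : 𝒮.IsTraj x w y) (e : R[X]) :
    op e y = ∑ v, 𝒮.obs e v • x v + ∑ k, op (𝒮.resp k e) (w k) := by
  induction e using Polynomial.induction_on' with
  | add p q hp hq =>
    rw [op_add, hp, hq, obs_add]
    simp only [Pi.add_apply, add_smul, Finset.sum_add_distrib, map_add, op_add]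
    abel
  | monomial i c =>
    ext j
    simp only [op_monomial, obs_monomial, resp_monomial, h.out_add, Pi.add_apply, Finset.sum_apply,
      Pi.smul_apply, smul_add, Finset.smul_sum, op_smul, smul_smul, smul_eq_mul]

/-- A relation `C a(A) = 0` yields an equation between the output and the inputs. -/
lemma IsTraj.op_out_of_obs_eq_zero {x : ι → ℕ → M} {w : J → ℕ → M} {y : ℕ → M}
    (h : 𝒮.IsTraj x w y) {a : R[X]} (ha : 𝒮.obs a = 0) :
    op a y = ∑ k, op (𝒮.resp k a) (w k) := by
  simp [h.op_out, ha]

end StateSpace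
end LinearIdent

namespace LinearIdent

/-! ### Separating field elements by embeddings and by points -/

/-- Two extensions of a field can be amalgamated, in a residue field of their tensor product. -/
lemma exists_amalgam {E K L : Type} [Field E] [Field K] [Field L] (i : E →+* K) (j : E →+* L) :
    ∃ (N : Type) (_ : Field N) (σ : K →+* N) (τ : L →+* N), σ.comp i = τ.comp j := by
  let := i.toAlgebra
  let := j.toAlgebra
  obtain ⟨m, hm⟩ := Ideal.exists_maximal (TensorProduct E K L)
  refine ⟨TensorProduct E K L ⧸ m, Ideal.Quotient.field m,
    (Ideal.Quotient.mk m).comp (algebraMap K (TensorProduct E K L)),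
    (Ideal.Quotient.mk m).comp (Algebra.TensorProduct.includeRight (R := E) (A := K)).toRingHom, ?_⟩
  ext e
  have h1 := Algebra.TensorProduct.algebraMap_apply (R := E) (S := E) (A := K) (B := L) e
  have h2 := Algebra.TensorProduct.algebraMap_apply' (R := E) (A := K) (B := L) e
  exact congrArg (Ideal.Quotient.mk m) (h1.symm.trans h2)

/-- In characteristic zero, an element outside the base field is moved by some embedding. -/
lemma exists_embeddings_ne {F K : Type} [Field F] [Field K] [Algebra F K] [CharZero F] {h : K}
    (hh : h ∉ Set.range (algebraMap F K)) :
    ∃ (N : Type) (_ : Field N) (σ τ : K →+* N),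
      σ.comp (algebraMap F K) = τ.comp (algebraMap F K) ∧ σ h ≠ τ h := by
  let L := AlgebraicClosure K
  obtain ⟨φ, hφ⟩ : ∃ φ : IntermediateField.adjoin F {h} →ₐ[F] L,
      φ (IntermediateField.AdjoinSimple.gen F h) ≠ algebraMap K L h := by
    by_cases hal : IsIntegral F h
    · -- an algebraic element is moved to another root of its separable minimal polynomial
      have hmin : minpoly F (algebraMap K L h) = minpoly F h :=
        minpoly.algebraMap_eq (algebraMap K L).injective h
      have hsep : IsSeparable F (algebraMap K L h) := by
        rw [IsSeparable, hmin]
        exact (minpoly.irreducible hal).separable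
      have hbot : algebraMap K L h ∉ (⊥ : Subalgebra F L) := by
        rw [Algebra.mem_bot]
        rintro ⟨c, hc⟩
        rw [IsScalarTower.algebraMap_apply F K L] at hc
        exact hh ⟨c, (algebraMap K L).injective hc⟩
      obtain ⟨y, hy, hconj⟩ :=
        (notMem_iff_exists_ne_and_isConjRoot hsep (IsAlgClosed.splits _)).1 hbot
      have hroot : y ∈ (minpoly F h).aroots L := by
        rw [Polynomial.mem_aroots]
        refine ⟨minpoly.ne_zero hal, ?_⟩
        have : minpoly F y = minpoly F h := by rw [← hmin]; exact hconj.symm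
        rw [← this]
        exact minpoly.aeval F y
      refine ⟨(IntermediateField.algHomAdjoinIntegralEquiv F hal).symm ⟨y, hroot⟩, ?_⟩
      rw [IntermediateField.algHomAdjoinIntegralEquiv_symm_apply_gen]
      exact hy.symm
    · -- a transcendental element `h` is moved to `h ^ 2`
      have htr : Transcendental F h := fun h' => hal h'.isIntegral
      have htr2 : Transcendental F (h ^ 2) := htr.pow (by norm_num)
      refine ⟨(IsScalarTower.toAlgHom F K L).comp ((IntermediateField.val _).comp
        (((RatFunc.algEquivOfTranscendental h htr).symm.trans
          (RatFunc.algEquivOfTranscendental (h ^ 2) htr2)).toAlgHom)), ?_⟩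
      have hval : ((IntermediateField.val _).comp
        (((RatFunc.algEquivOfTranscendental h htr).symm.trans
          (RatFunc.algEquivOfTranscendental (h ^ 2) htr2)).toAlgHom))
            (IntermediateField.AdjoinSimple.gen F h) = h ^ 2 := by
        simp [RatFunc.algEquivOfTranscendental_symm_gen, RatFunc.algEquivOfTranscendental_X]
      rw [AlgHom.comp_apply, hval]
      intro h2
      have h3 : h ^ 2 = h := (algebraMap K L).injective h2
      rcases eq_or_ne h 0 with h0 | h0
      · exact hh ⟨0, by simp [h0]⟩
      · exact hh ⟨1, by rw [map_one]; exact (mul_left_cancel₀ h0 (by rw [mul_one, ← sq, h3])).symm⟩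
  obtain ⟨N, _, σ, τ, hστ⟩ := exists_amalgam
    (algebraMap (IntermediateField.adjoin F {h}) K) φ.toRingHom
  refine ⟨N, inferInstance, σ, τ.comp (algebraMap K L), ?_, ?_⟩
  · ext c
    have h1 := congr($hστ (algebraMap F _ c))
    have h2 : φ (algebraMap F _ c) = algebraMap K L (algebraMap F K c) := by
      rw [AlgHom.commutes, IsScalarTower.algebraMap_apply F K L]
    exact h1.trans (congrArg τ h2)
  · have h1 := congr($hστ (IntermediateField.AdjoinSimple.gen F h))
    intro h2
    have h3 : τ (φ (IntermediateField.AdjoinSimple.gen F h)) = τ (algebraMap K L h) :=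
      h1.symm.trans h2
    exact hφ (τ.injective h3)

/-! ### Values of rational functions at points -/

open MvPolynomial

variable {l : ℕ}

/-- The numerator of a rational function, in lowest terms. -/
abbrev numer (h : ParamField l) : MvPolynomial (Fin l) ℂ :=
  IsFractionRing.num (MvPolynomial (Fin l) ℂ) h

/-- The denominator of a rational function, in lowest terms. -/
abbrev denom (h : ParamField l) : MvPolynomial (Fin l) ℂ :=
  (IsFractionRing.den (MvPolynomial (Fin l) ℂ) h : MvPolynomial (Fin l) ℂ)

lemma denom_ne_zero (h : ParamField l) : denom h ≠ 0 := nonZeroDivisors.coe_ne_zero _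

lemma algebraMap_injective :
    Function.Injective (algebraMap (MvPolynomial (Fin l) ℂ) (ParamField l)) :=
  IsFractionRing.injective _ _

lemma mul_denom (h : ParamField l) :
    h * algebraMap _ _ (denom h) = algebraMap _ (ParamField l) (numer h) := by
  have := IsFractionRing.mk'_num_den' (MvPolynomial (Fin l) ℂ) h
  rw [div_eq_iff] at this
  · exact this.symm
  rw [Ne, map_eq_zero_iff _ algebraMap_injective]
  exact denom_ne_zero h

/-- Any fraction whose denominator does not vanish at `μ` computes the value at `μ`. -/
lemma definedAt_of_mul_eq {h : ParamField l} {μ : Fin l → ℂ} {a b : MvPolynomial (Fin l) ℂ}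
    (hb : eval μ b ≠ 0) (hab : h * algebraMap _ _ b = algebraMap _ (ParamField l) a) :
    DefinedAt h μ ∧ ratEval h μ = eval μ a / eval μ b := by
  have key : numer h * b = a * denom h := by
    apply algebraMap_injective
    rw [map_mul, map_mul, ← mul_denom, ← hab]
    ring
  have hdvd : denom h ∣ b := by
    have h1 : IsRelPrime (numer h) (denom h) := IsFractionRing.num_den_reduced _ h
    exact h1.symm.dvd_of_dvd_mul_left ⟨a, by rw [key, mul_comm]⟩
  have hDμ : eval μ (denom h) ≠ 0 := by
    obtain ⟨c, hc⟩ := hdvd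
    intro h0
    exact hb (by rw [hc, map_mul, h0, zero_mul])
  refine ⟨hDμ, ?_⟩
  change eval μ (numer h) / eval μ (denom h) = _
  rw [div_eq_div_iff hDμ hb, ← map_mul, ← map_mul, key]

lemma definedAt_algebraMap (a : MvPolynomial (Fin l) ℂ) (μ : Fin l → ℂ) :
    DefinedAt (algebraMap _ (ParamField l) a) μ ∧
      ratEval (algebraMap _ (ParamField l) a) μ = eval μ a := by
  simpa using definedAt_of_mul_eq (h := algebraMap _ (ParamField l) a) (μ := μ) (a := a) (b := 1)
    (by simp) (by simp)

lemma definedAt_add {h k : ParamField l} {μ : Fin l → ℂ} (hh : DefinedAt h μ)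
    (hk : DefinedAt k μ) :
    DefinedAt (h + k) μ ∧ ratEval (h + k) μ = ratEval h μ + ratEval k μ := by
  have := definedAt_of_mul_eq (h := h + k) (μ := μ)
    (a := numer h * denom k + denom h * numer k) (b := denom h * denom k)
    (by rw [map_mul]; exact mul_ne_zero hh hk)
    (by rw [map_mul, map_add, map_mul, map_mul, ← mul_denom, ← mul_denom]; ring)
  refine ⟨this.1, this.2.trans ?_⟩
  rw [ratEval, ratEval, div_add_div _ _ hh hk]
  simp only [map_mul, map_add]

lemma definedAt_mul {h k : ParamField l} {μ : Fin l → ℂ} (hh : DefinedAt h μ)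
    (hk : DefinedAt k μ) :
    DefinedAt (h * k) μ ∧ ratEval (h * k) μ = ratEval h μ * ratEval k μ := by
  have := definedAt_of_mul_eq (h := h * k) (μ := μ)
    (a := numer h * numer k) (b := denom h * denom k)
    (by rw [map_mul]; exact mul_ne_zero hh hk)
    (by rw [map_mul, map_mul, ← mul_denom, ← mul_denom]; ring)
  refine ⟨this.1, this.2.trans ?_⟩
  rw [ratEval, ratEval, div_mul_div_comm]
  simp only [map_mul]

@[simp] lemma ratEval_zero (μ : Fin l → ℂ) : ratEval (0 : ParamField l) μ = 0 := by
  have := (definedAt_algebraMap (0 : MvPolynomial (Fin l) ℂ) μ).2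
  rwa [map_zero, map_zero] at this

/-- The local ring of a point: the rational functions that are well-defined there. -/
def localRing (μ : Fin l → ℂ) : Subalgebra (MvPolynomial (Fin l) ℂ) (ParamField l) where
  carrier := {h | DefinedAt h μ}
  mul_mem' hh hk := (definedAt_mul hh hk).1
  add_mem' hh hk := (definedAt_add hh hk).1
  algebraMap_mem' a := (definedAt_algebraMap a μ).1

/-- Evaluation at a point, on the local ring of the point. -/
def evalHom (μ : Fin l → ℂ) : localRing μ →+* ℂ where
  toFun h := ratEval h.1 μ
  map_one' := by simpa using (definedAt_algebraMap (1 : MvPolynomial (Fin l) ℂ) μ).2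
  map_zero' := ratEval_zero μ
  map_add' h k := (definedAt_add h.2 k.2).2
  map_mul' h k := (definedAt_mul h.2 k.2).2

/-- The polynomials that do not vanish at a point. -/
def nonvanishing (μ : Fin l → ℂ) : Submonoid (MvPolynomial (Fin l) ℂ) :=
  (nonZeroDivisors ℂ).comap (eval μ)

lemma mem_nonvanishing {μ : Fin l → ℂ} {b : MvPolynomial (Fin l) ℂ} :
    b ∈ nonvanishing μ ↔ eval μ b ≠ 0 := by
  simp [nonvanishing]

instance (μ : Fin l → ℂ) : IsLocalization (nonvanishing μ) (localRing μ) where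
  map_units := by
    rintro ⟨b, hb⟩
    rw [mem_nonvanishing] at hb
    have hb0 : algebraMap _ (ParamField l) b ≠ 0 := by
      rw [Ne, map_eq_zero_iff _ algebraMap_injective]
      rintro rfl
      simp at hb
    have hinv : DefinedAt (algebraMap _ (ParamField l) b)⁻¹ μ :=
      (definedAt_of_mul_eq (a := 1) hb (by rw [inv_mul_cancel₀ hb0, map_one])).1
    refine IsUnit.of_mul_eq_one (⟨_, hinv⟩ : localRing μ) ?_
    ext
    exact mul_inv_cancel₀ hb0
  surj := by
    rintro ⟨h, hh⟩
    refine ⟨⟨numer h, ⟨denom h, mem_nonvanishing.2 hh⟩⟩, ?_⟩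
    ext
    exact mul_denom h
  exists_of_eq := by
    intro a b hab
    have : a = b := algebraMap_injective congr(($hab).1)
    exact ⟨1, by rw [this]⟩

lemma nonvanishing_le (μ : Fin l → ℂ) : nonvanishing μ ≤ nonZeroDivisors _ := by
  intro b hb
  rw [mem_nonvanishing] at hb
  rw [mem_nonZeroDivisors_iff_ne_zero]
  rintro rfl
  simp at hb

instance (μ : Fin l → ℂ) : IsIntegrallyClosed (localRing μ) :=
  isIntegrallyClosed_of_isLocalization _ _ (nonvanishing_le μ)

instance (μ : Fin l → ℂ) : IsFractionRing (localRing μ) (ParamField l) :=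
  IsFractionRing.isFractionRing_of_isDomain_of_isLocalization (nonvanishing μ) _ _

/-- A monic divisor of a monic polynomial with coefficients in the local ring of a point has its
coefficients in this local ring, as the local ring is integrally closed. -/
lemma exists_monic_lift_of_dvd {μ : Fin l → ℂ} {χ : Polynomial (localRing μ)} (hχ : χ.Monic)
    {a : Polynomial (ParamField l)} (ha : a.Monic)
    (hdvd : a ∣ χ.map (algebraMap (localRing μ) (ParamField l))) :
    ∃ a' : Polynomial (localRing μ), a'.map (algebraMap (localRing μ) (ParamField l)) = a := by
  obtain ⟨a', ha'⟩ := IsIntegrallyClosed.eq_map_mul_C_of_dvd (ParamField l) hχ hdvd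
  exact ⟨a', by simpa [ha.leadingCoeff] using ha'⟩

/-- Elements that take equal values at two points form a `ℂ`-algebra. -/
lemma definedAt_adjoin {s : Set (ParamField l)} {μ ν : Fin l → ℂ}
    (hs : ∀ c ∈ s, DefinedAt c μ ∧ DefinedAt c ν ∧ ratEval c μ = ratEval c ν) {r : ParamField l}
    (hr : r ∈ Algebra.adjoin ℂ s) : DefinedAt r μ ∧ DefinedAt r ν ∧ ratEval r μ = ratEval r ν := by
  induction hr using Algebra.adjoin_induction with
  | mem c hc => exact hs c hc
  | algebraMap c =>
    rw [IsScalarTower.algebraMap_apply ℂ (MvPolynomial (Fin l) ℂ) (ParamField l)]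
    refine ⟨(definedAt_algebraMap _ μ).1, (definedAt_algebraMap _ ν).1, ?_⟩
    rw [(definedAt_algebraMap _ μ).2, (definedAt_algebraMap _ ν).2]
    simp
  | add a b _ _ ha hb =>
    refine ⟨(definedAt_add ha.1 hb.1).1, (definedAt_add ha.2.1 hb.2.1).1, ?_⟩
    rw [(definedAt_add ha.1 hb.1).2, (definedAt_add ha.2.1 hb.2.1).2, ha.2.2, hb.2.2]
  | mul a b _ _ ha hb =>
    refine ⟨(definedAt_mul ha.1 hb.1).1, (definedAt_mul ha.2.1 hb.2.1).1, ?_⟩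
    rw [(definedAt_mul ha.1 hb.1).2, (definedAt_mul ha.2.1 hb.2.1).2, ha.2.2, hb.2.2]

/-- The values of generators at a generic point determine the values of every element of the
field that they generate. -/
lemma exists_ratEval_eq_of_mem_adjoin {s : Set (ParamField l)} {h : ParamField l}
    (hh : h ∈ IntermediateField.adjoin ℂ s) :
    ∃ Q : MvPolynomial (Fin l) ℂ, Q ≠ 0 ∧ ∀ μ ν, eval μ Q ≠ 0 → DefinedAt h μ → DefinedAt h ν →
      (∀ c ∈ s, DefinedAt c μ ∧ DefinedAt c ν ∧ ratEval c μ = ratEval c ν) →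
      ratEval h μ = ratEval h ν := by
  obtain ⟨r, hr, t, ht, rfl⟩ := IntermediateField.mem_adjoin_iff_div.1 hh
  rcases eq_or_ne t 0 with rfl | ht0
  · exact ⟨1, one_ne_zero, fun μ ν _ _ _ _ => by simp⟩
  refine ⟨numer t, by rwa [Ne, IsFractionRing.num_eq_zero], fun μ ν hQ hμ hν hs => ?_⟩
  obtain ⟨-, -, hr3⟩ := definedAt_adjoin hs hr
  obtain ⟨ht1, ht2, ht3⟩ := definedAt_adjoin hs ht
  have htμ : ratEval t μ ≠ 0 := div_ne_zero hQ ht1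
  have e1 := (definedAt_mul hμ ht1).2
  have e2 := (definedAt_mul hν ht2).2
  rw [div_mul_cancel₀ _ ht0] at e1 e2
  rw [← ht3, ← hr3, e1] at e2
  exact mul_right_cancel₀ htμ e2

/-- A rational function outside the field generated by `s` separates two generic points that the
elements of `s` do not separate. Two embeddings of `ℂ(μ)` in a field that agree on the subfield
but not on `h` form a generic point of a set of pairs of points on which the elements of `s` agree;
by the Nullstellensatz, this set contains a pair with complex coordinates that avoids the
exceptional hypersurfaces. -/
lemma exists_points_of_notMem_adjoin {s : Set (ParamField l)} {h : ParamField l}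
    (hh : h ∉ IntermediateField.adjoin ℂ s) {G : MvPolynomial (Fin l) ℂ} (hG : G ≠ 0) :
    ∃ μ ν : Fin l → ℂ, eval μ G ≠ 0 ∧ eval ν G ≠ 0 ∧ DefinedAt h μ ∧ DefinedAt h ν ∧
      ratEval h μ ≠ ratEval h ν ∧
      ∀ c ∈ s, DefinedAt c μ → DefinedAt c ν → ratEval c μ = ratEval c ν := by
  set F := IntermediateField.adjoin ℂ s
  obtain ⟨N, _, σ, τ, hστ, hne⟩ := exists_embeddings_ne (F := F) (K := ParamField l) (h := h)
    (by rintro ⟨c, rfl⟩; exact hh c.2)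
  have hF : ∀ c ∈ F, σ c = τ c := fun c hc => congr($hστ ⟨c, hc⟩)
  let ι := algebraMap (MvPolynomial (Fin l) ℂ) (ParamField l)
  let := (σ.comp (algebraMap ℂ (ParamField l))).toAlgebra
  have hτC : ∀ z : ℂ, algebraMap ℂ N z = τ (algebraMap ℂ (ParamField l) z) := fun z =>
    hF _ (F.algebraMap_mem z)
  -- pairs of points are described by the polynomials in two copies of the parameters
  let Φ : MvPolynomial (Fin l ⊕ Fin l) ℂ →ₐ[ℂ] N :=
    aeval (Sum.elim (fun i => σ (ι (X i))) fun i => τ (ι (X i)))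
  have hΦ1 : ∀ a, Φ (rename Sum.inl a) = σ (ι a) := by
    intro a
    induction a using MvPolynomial.induction_on with
    | C z =>
      rw [rename_C, ← algebraMap_eq, AlgHom.commutes]
      rfl
    | add p q hp hq => simp only [map_add, hp, hq]
    | mul_X p i hp => rw [map_mul, map_mul, hp, map_mul, map_mul]; simp [Φ]
  have hΦ2 : ∀ a, Φ (rename Sum.inr a) = τ (ι a) := by
    intro a
    induction a using MvPolynomial.induction_on with
    | C z =>
      rw [rename_C, ← algebraMap_eq, AlgHom.commutes, hτC]
      rfl
    | add p q hp hq => simp only [map_add, hp, hq]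
    | mul_X p i hp => rw [map_mul, map_mul, hp, map_mul, map_mul]; simp [Φ]
  have hι : ∀ {a}, a ≠ 0 → ι a ≠ 0 := fun ha => by
    rwa [Ne, map_eq_zero_iff _ algebraMap_injective]
  have hσ : ∀ {a}, a ≠ 0 → σ (ι a) ≠ 0 := fun ha => by
    rw [Ne, map_eq_zero]; exact hι ha
  have hτ : ∀ {a}, a ≠ 0 → τ (ι a) ≠ 0 := fun ha => by
    rw [Ne, map_eq_zero]; exact hι ha
  let D : ParamField l → MvPolynomial (Fin l ⊕ Fin l) ℂ := fun c =>
    rename Sum.inl (numer c) * rename Sum.inr (denom c) -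
      rename Sum.inr (numer c) * rename Sum.inl (denom c)
  have hD : ∀ c, Φ (D c) = (σ c - τ c) * (σ (ι (denom c)) * τ (ι (denom c))) := by
    intro c
    simp only [D, map_sub, map_mul, hΦ1, hΦ2]
    have e1 : ι (numer c) = c * ι (denom c) := (mul_denom c).symm
    rw [e1, map_mul, map_mul]
    ring
  let P : Ideal (MvPolynomial (Fin l ⊕ Fin l) ℂ) := RingHom.ker Φ
  have : P.IsPrime := RingHom.ker_isPrime _
  let Q := rename Sum.inl (G * denom h) * rename Sum.inr (G * denom h) * D h
  have hQ : Q ∉ P := by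
    rw [RingHom.mem_ker]
    simp only [Q, map_mul, hΦ1, hΦ2, hD]
    exact mul_ne_zero (mul_ne_zero (mul_ne_zero (hσ hG) (hσ (denom_ne_zero h)))
      (mul_ne_zero (hτ hG) (hτ (denom_ne_zero h))))
      (mul_ne_zero (sub_ne_zero.2 hne) (mul_ne_zero (hσ (denom_ne_zero h)) (hτ (denom_ne_zero h))))
  rw [← IsPrime.vanishingIdeal_zeroLocus (K := ℂ) P, mem_vanishingIdeal_iff] at hQ
  push Not at hQ
  obtain ⟨z, hz, hQz⟩ := hQ
  have hz1 : ∀ a, aeval z (rename Sum.inl a) = eval (z ∘ Sum.inl) a := fun a => by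
    rw [aeval_rename]; rfl
  have hz2 : ∀ a, aeval z (rename Sum.inr a) = eval (z ∘ Sum.inr) a := fun a => by
    rw [aeval_rename]; rfl
  simp only [Q, D, map_mul, map_sub, hz1, hz2, mul_ne_zero_iff, sub_ne_zero] at hQz
  obtain ⟨⟨⟨g1, d1⟩, g2, d2⟩, hne'⟩ := hQz
  refine ⟨z ∘ Sum.inl, z ∘ Sum.inr, g1, g2, d1, d2, ?_, fun c hc hc1 hc2 => ?_⟩
  · rw [ratEval, ratEval, Ne, div_eq_div_iff d1 d2]
    exact hne'
  · have hDc : D c ∈ P := by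
      rw [RingHom.mem_ker, hD, hF c (IntermediateField.subset_adjoin _ _ hc), sub_self, zero_mul]
    have := hz _ hDc
    simp only [D, map_mul, map_sub, hz1, hz2, sub_eq_zero] at this
    rw [ratEval, ratEval, div_eq_div_iff hc1 hc2]
    exact this

end LinearIdent

namespace LinearIdent
open Polynomial Matrix

/-! ### Solutions and input-output equations over a field -/

/-- A monic operator determines a sequence from its first terms. -/
lemma eq_zero_of_op_eq_zero {R : Type*} [CommRing R] {a : R[X]} (ha : a.Monic) {d : ℕ → R}
    (hd : op a d = 0) (h0 : ∀ i < a.natDegree, d i = 0) : d = 0 := by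
  ext j
  induction j using Nat.strong_induction_on with
  | _ j ih =>
    rcases lt_or_ge j a.natDegree with hj | hj
    · exact h0 j hj
    obtain ⟨m, rfl⟩ := Nat.exists_eq_add_of_le hj
    have h1 := congr_fun hd m
    rw [op_apply, sum_over_range _ (by simp), Finset.sum_range_succ, ha.coeff_natDegree,
      Finset.sum_eq_zero, zero_add, one_smul] at h1
    · exact h1
    · intro i hi
      rw [Finset.mem_range] at hi
      rw [ih (i + m) (by omega)]
      simp

namespace StateSpace

section Ring

variable {R ι J : Type*} [CommRing R] [Fintype ι] [Fintype J]
  (𝒮 : StateSpace R ι J)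

/-- The derivatives at `0` of the state of a solution, for the initial state `x₀`. -/
def stateSeq (w : J → ℕ → R) (x₀ : ι → R) : ℕ → ι → R
  | 0 => x₀
  | j + 1 => 𝒮.A *ᵥ stateSeq w x₀ j + 𝒮.B *ᵥ fun k => w k j

/-- The derivatives at `0` of the output of a solution, for the initial state `x₀`. -/
def outSeq (w : J → ℕ → R) (x₀ : ι → R) (j : ℕ) : R :=
  𝒮.C ⬝ᵥ 𝒮.stateSeq w x₀ j + 𝒮.D ⬝ᵥ fun k => w k j

lemma isTraj_outSeq (w : J → ℕ → R) (x₀ : ι → R) :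
    𝒮.IsTraj (fun v j => 𝒮.stateSeq w x₀ j v) w (𝒮.outSeq w x₀) where
  state _ _ := rfl
  out _ := rfl

variable {𝒮} in
lemma IsTraj.eq_outSeq {x : ι → ℕ → R} {w : J → ℕ → R} {y : ℕ → R} (h : 𝒮.IsTraj x w y) :
    y = 𝒮.outSeq w fun v => x v 0 := by
  have hx : ∀ j, (fun v => x v j) = 𝒮.stateSeq w (fun v => x v 0) j := by
    intro j
    induction j with
    | zero => rfl
    | succ j ih =>
      rw [stateSeq, ← ih]
      ext v
      exact h.state v j
  ext j
  rw [h.out, outSeq, ← hx]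
  rfl

variable [DecidableEq ι] {R' κ : Type*} [CommRing R']

/-- The Hankel matrix of the derivative of the free response of the system, from the `m`-th
derivative on. -/
def hankel (𝒮 : StateSpace R ι (Option κ)) (x₀ : ι → R) (m s : ℕ) : Matrix (Fin s) (Fin s) R :=
  Matrix.of fun i j => 𝒮.obs (X ^ (m + j + i)) ⬝ᵥ (𝒮.A *ᵥ x₀ + fun i => 𝒮.B i none)

lemma hankel_map (𝒮 : StateSpace R ι (Option κ)) (x₀ : ι → R) (m s : ℕ) (φ : R →+* R') :
    (𝒮.map φ).hankel (φ ∘ x₀) m s = (𝒮.hankel x₀ m s).map φ := by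
  ext i j
  have h := 𝒮.obs_map φ (X ^ (m + j + i))
  rw [Polynomial.map_pow, Polynomial.map_X] at h
  simp [hankel, h, dotProduct, mulVec]

end Ring

section Field

variable {k ι κ : Type*} [Field k] [Fintype ι] [DecidableEq ι] [Fintype κ]

/-- The inputs of a system together with the constant function `1`. -/
def withUnit (u : κ → ℕ → k) : Option κ → ℕ → k := fun o => o.elim (unitSeq k) u

lemma sum_op_withUnit (f : Option κ → k[X]) (u : κ → ℕ → k) :
    ∑ o, op (f o) (withUnit u o) = ∑ i, op (f (some i)) (u i) + (f none).coeff 0 • unitSeq k := by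
  rw [Fintype.sum_option, add_comm]
  congr 1
  exact op_unitSeq _

/-- If two systems satisfy the same input-output equation and the second one is observable up to
the order of the equation, then the second one reproduces every output of the first. -/
lemma exists_outSeq_eq {𝒮 𝒯 : StateSpace k ι (Option κ)} {a : k[X]} (ha : a.Monic)
    (h𝒮 : 𝒮.obs a = 0) (h𝒯 : 𝒯.obs a = 0)
    (hsome : ∀ i, 𝒮.resp (some i) a = 𝒯.resp (some i) a)
    (hnone : (𝒮.resp none a).coeff 0 = (𝒯.resp none a).coeff 0)
    (hsurj : ∀ t : ℕ → k, ∃ x, ∀ i < a.natDegree, 𝒯.obs (X ^ i) ⬝ᵥ x = t i)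
    (u : κ → ℕ → k) (x₀ : ι → k) :
    ∃ x₁, 𝒯.outSeq (withUnit u) x₁ = 𝒮.outSeq (withUnit u) x₀ := by
  obtain ⟨x₁, hx₁⟩ := hsurj fun i =>
    𝒮.outSeq (withUnit u) x₀ i - ∑ o, op (𝒯.tau o i) (withUnit u o) 0
  refine ⟨x₁, sub_eq_zero.1 (eq_zero_of_op_eq_zero ha ?_ fun i hi => ?_)⟩
  · rw [map_sub, (𝒮.isTraj_outSeq _ _).op_out_of_obs_eq_zero h𝒮,
      (𝒯.isTraj_outSeq _ _).op_out_of_obs_eq_zero h𝒯, sum_op_withUnit, sum_op_withUnit, hnone]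
    simp [hsome]
  · have h1 := (𝒯.isTraj_outSeq (withUnit u) x₁).out_add i 0
    have h2 := hx₁ i hi
    rw [Pi.sub_apply, ← add_zero i, h1, add_zero, sub_eq_zero]
    simp only [stateSeq, smul_eq_mul]
    rw [dotProduct] at h2
    rw [h2, sub_add_cancel]

/-- Inputs that do not satisfy any nontrivial linear differential equation of order at most `N`
with constant coefficients. -/
def InputGeneric (N : ℕ) (u : κ → ℕ → k) : Prop :=
  ∀ (f : κ → k[X]) (c : k), (∀ i, (f i).natDegree ≤ N) →
    ∑ i, op (f i) (u i) + c • unitSeq k = 0 → ∀ i, f i = 0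

variable {𝒮 : StateSpace k ι (Option κ)} {u : κ → ℕ → k} {x₀ : ι → k}

/-- For a generic input, no linear combination of the states is a linear combination of
derivatives of the inputs and of `1`, unless it is constant: the characteristic polynomial of `A`
yields an equation in which the inputs have lower order. That equation is compared with the given
one multiplied by the characteristic polynomial, hence the order `2 * card ι`. -/
lemma coeff_eq_zero_of_state_eq (hu : InputGeneric (2 * Fintype.card ι) u) {v : ι → k}
    {d : κ → k[X]} {c : k} (hd : ∀ i, (d i).natDegree ≤ Fintype.card ι)
    (hv : (fun j => v ⬝ᵥ 𝒮.stateSeq (withUnit u) x₀ j) =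
      ∑ i, op (d i) (u i) + c • unitSeq k) (i : κ) : d i = 0 := by
  let 𝒱 : StateSpace k ι (Option κ) := { 𝒮 with C := v, D := 0 }
  have htraj : 𝒱.IsTraj (fun v j => 𝒮.stateSeq (withUnit u) x₀ j v) (withUnit u)
      (fun j => v ⬝ᵥ 𝒮.stateSeq (withUnit u) x₀ j) := by
    refine ⟨fun _ _ => rfl, fun j => ?_⟩
    simp [𝒱, dotProduct]
  set χ := 𝒮.A.charpoly
  have hχ0 : χ ≠ 0 := 𝒮.A.charpoly_monic.ne_zero
  have hdeg : χ.natDegree = Fintype.card ι := 𝒮.A.charpoly_natDegree_eq_dim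
  have hχ : 𝒱.obs χ = 0 := 𝒱.obs_charpoly
  have hlt : ∀ o, (𝒱.resp o χ).degree < χ.degree := fun o => 𝒱.degree_resp_lt rfl o hχ0
  have h1 := htraj.op_out_of_obs_eq_zero hχ
  rw [hv, sum_op_withUnit, map_add, map_sum, map_smul, op_unitSeq] at h1
  have h2 : ∀ i, χ * d i - 𝒱.resp (some i) χ = 0 := by
    refine hu _ (c * χ.coeff 0 - (𝒱.resp none χ).coeff 0) (fun i => ?_) ?_
    · refine (natDegree_sub_le _ _).trans (max_le ?_ ?_)
      · exact natDegree_mul_le.trans (by have := hd i; omega)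
      · exact (𝒱.natDegree_resp_le _ _).trans (by omega)
    · simp only [op_sub, op_mul, Finset.sum_sub_distrib, sub_smul, mul_smul]
      rw [← sub_eq_zero] at h1
      rw [← h1]
      abel
  by_contra hne
  have h3 := hlt (some i)
  rw [← sub_eq_zero.1 (h2 i), degree_mul] at h3
  have h4 : (0 : WithBot ℕ) ≤ (d i).degree := zero_le_degree_iff.2 hne
  exact absurd h3 (not_lt.2 (le_add_of_nonneg_right h4))

/-- For a generic input, if a combination of the states is constant in time, then the combination
obtained by applying `A` is constant too, and the initial state is at equilibrium with respect to
the combination. -/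
lemma state_const_step (hu : InputGeneric (2 * Fintype.card ι) u) {v : ι → k} {c : k}
    (hv : (fun j => v ⬝ᵥ 𝒮.stateSeq (withUnit u) x₀ j) = c • unitSeq k) :
    (∃ c' : k, (fun j => (v ᵥ* 𝒮.A) ⬝ᵥ 𝒮.stateSeq (withUnit u) x₀ j) = c' • unitSeq k) ∧
      v ⬝ᵥ (𝒮.A *ᵥ x₀ + fun i => 𝒮.B i none) = 0 := by
  have h0 : ∀ j, (v ᵥ* 𝒮.A) ⬝ᵥ 𝒮.stateSeq (withUnit u) x₀ j =
      -∑ i, (v ᵥ* 𝒮.B) (some i) * u i j - (v ᵥ* 𝒮.B) none * unitSeq k j := by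
    intro j
    have h1 := congr_fun hv (j + 1)
    simp only [stateSeq, dotProduct_add, dotProduct_mulVec, Pi.smul_apply, unitSeq,
      Pi.single_eq_of_ne (Nat.succ_ne_zero j), smul_zero] at h1
    have h2 : (v ᵥ* 𝒮.B) ⬝ᵥ (fun o => withUnit u o j) =
        (v ᵥ* 𝒮.B) none * unitSeq k j + ∑ i, (v ᵥ* 𝒮.B) (some i) * u i j := by
      rw [dotProduct, Fintype.sum_option]
      rfl
    rw [h2] at h1
    linear_combination h1
  have h3 : ∀ i, Polynomial.C (-(v ᵥ* 𝒮.B) (some i)) = 0 := by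
    refine coeff_eq_zero_of_state_eq (𝒮 := 𝒮) (x₀ := x₀) (v := v ᵥ* 𝒮.A)
      (c := -(v ᵥ* 𝒮.B) none) hu (by simp) ?_
    ext j
    rw [h0]
    simp [Finset.sum_apply, -map_neg]
    ring
  have h4 : ∀ i, (v ᵥ* 𝒮.B) (some i) = 0 := fun i => by simpa using h3 i
  have h5 : (fun j => (v ᵥ* 𝒮.A) ⬝ᵥ 𝒮.stateSeq (withUnit u) x₀ j) =
      (-(v ᵥ* 𝒮.B) none) • unitSeq k := by
    ext j
    rw [h0]
    simp [h4]
  refine ⟨⟨_, h5⟩, ?_⟩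
  have h6 := congr_fun h5 0
  simp only [stateSeq, unitSeq, Pi.smul_apply, Pi.single_eq_same, smul_eq_mul, mul_one] at h6
  rw [dotProduct_add, dotProduct_mulVec, h6]
  exact neg_add_cancel _

/-- By induction from `coeff_eq_zero_of_state_eq` and `state_const_step`: a combination of the
states that is expressed through the inputs and `1` satisfies an equilibrium condition for all
powers of `A`. -/
lemma state_const_pow (hu : InputGeneric (2 * Fintype.card ι) u) {v : ι → k} {d : κ → k[X]} {c : k}
    (hd : ∀ i, (d i).natDegree ≤ Fintype.card ι)
    (hv : (fun j => v ⬝ᵥ 𝒮.stateSeq (withUnit u) x₀ j) =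
      ∑ i, op (d i) (u i) + c • unitSeq k) (m : ℕ) :
    (v ᵥ* 𝒮.A ^ m) ⬝ᵥ (𝒮.A *ᵥ x₀ + fun i => 𝒮.B i none) = 0 := by
  have h0 := coeff_eq_zero_of_state_eq hu hd hv
  simp only [h0, op_zero, Finset.sum_const_zero, zero_add] at hv
  have h1 : ∃ c' : k,
      (fun j => (v ᵥ* 𝒮.A ^ m) ⬝ᵥ 𝒮.stateSeq (withUnit u) x₀ j) = c' • unitSeq k := by
    induction m with
    | zero => exact ⟨c, by simpa using hv⟩
    | succ m ih =>
      obtain ⟨c', hc'⟩ := ih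
      obtain ⟨c'', hc''⟩ := (state_const_step hu hc').1
      exact ⟨c'', by rw [pow_succ, ← vecMul_vecMul]; exact hc''⟩
  obtain ⟨c', hc'⟩ := h1
  exact (state_const_step hu hc').2

/-- Two input-output equations of the same order with a common generic solution coincide. The
equations may be divisible by `X ^ m`: then constants are among the solutions, so that the generic
solution may satisfy an equation of lower order that depends on the initial state, and only the
derivatives of the output are used.

The difference of the two equations has lower order in the output. It expresses a combination of
the states through the inputs, which the nonsingular Hankel matrix excludes unless the difference
does not contain the output; then it vanishes, as the input is generic. -/
lemma io_equation_unique {𝒯 : StateSpace k ι (Option κ)} {a b : k[X]} (ha : a.Monic) (hb : b.Monic)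
    {m s : ℕ} (hna : a.natDegree = m + s) (hnb : b.natDegree = m + s)
    (hcard : m + s ≤ Fintype.card ι) (hXa : X ^ m ∣ a) (hXb : X ^ m ∣ b)
    (h𝒮 : 𝒮.obs a = 0) (h𝒯 : 𝒯.obs b = 0) (hu : InputGeneric (2 * Fintype.card ι) u)
    (hH : (𝒮.hankel x₀ m s).det ≠ 0) {x₁ : ι → k}
    (hy : 𝒮.outSeq (withUnit u) x₀ = 𝒯.outSeq (withUnit u) x₁) :
    a = b ∧ (∀ i, 𝒮.resp (some i) a = 𝒯.resp (some i) b) ∧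
      (𝒮.resp none a).coeff 0 = (𝒯.resp none b).coeff 0 := by
  have e1 := (𝒮.isTraj_outSeq (withUnit u) x₀).op_out_of_obs_eq_zero h𝒮
  have e2 := (𝒯.isTraj_outSeq (withUnit u) x₁).op_out_of_obs_eq_zero h𝒯
  rw [← hy] at e2
  rw [sum_op_withUnit] at e1 e2
  have hdegS : ∀ i, (𝒮.resp (some i) a).natDegree ≤ m + s := fun i =>
    (𝒮.natDegree_resp_le _ _).trans hna.le
  have hdegT : ∀ i, (𝒯.resp (some i) b).natDegree ≤ m + s := fun i =>
    (𝒯.natDegree_resp_le _ _).trans hnb.le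
  have hab : a = b := by
    have hdeg : (a - b).degree < ((m + s : ℕ) : WithBot ℕ) := by
      have h1 : a.degree = ((m + s : ℕ) : WithBot ℕ) := by
        rw [degree_eq_natDegree ha.ne_zero, hna]
      have h2 : b.degree = ((m + s : ℕ) : WithBot ℕ) := by
        rw [degree_eq_natDegree hb.ne_zero, hnb]
      rw [← h1]
      exact degree_sub_lt_left (h1.trans h2.symm) ha.ne_zero (by rw [ha.leadingCoeff, hb.leadingCoeff])
    have hnat : (a - b).natDegree ≤ m + s := (natDegree_le_iff_degree_le).2 hdeg.le
    obtain ⟨e, he⟩ := dvd_sub hXa hXb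
    have e3 := (𝒮.isTraj_outSeq (withUnit u) x₀).op_out (a - b)
    rw [op_sub, e1, e2, sum_op_withUnit] at e3
    have hst : (fun j => 𝒮.obs (a - b) ⬝ᵥ 𝒮.stateSeq (withUnit u) x₀ j) =
        ∑ v, 𝒮.obs (a - b) v • fun j => 𝒮.stateSeq (withUnit u) x₀ j v := by
      ext j
      simp [dotProduct]
    have h4 := fun q => state_const_pow (𝒮 := 𝒮) (x₀ := x₀) (v := 𝒮.obs (a - b)) hu
      (d := fun i => 𝒮.resp (some i) a - 𝒯.resp (some i) b - 𝒮.resp (some i) (a - b))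
      (c := (𝒮.resp none a).coeff 0 - (𝒯.resp none b).coeff 0 - (𝒮.resp none (a - b)).coeff 0)
      (fun i => (natDegree_sub_le _ _).trans (max_le ((natDegree_sub_le _ _).trans
        (max_le ((hdegS i).trans hcard) ((hdegT i).trans hcard)))
        ((𝒮.natDegree_resp_le _ _).trans (hnat.trans hcard))))
      (by
        rw [hst]
        simp only [op_sub, Finset.sum_sub_distrib, sub_smul]
        rw [← sub_eq_iff_eq_add] at e3
        rw [← e3]
        abel) q
    have hedeg : e.natDegree < s ∨ e = 0 := by
      by_cases he0 : e = 0
      · exact Or.inr he0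
      left
      rw [he, degree_mul, degree_X_pow, degree_eq_natDegree he0, ← Nat.cast_add,
        Nat.cast_lt] at hdeg
      omega
    rcases hedeg with hes | he0
    swap
    · rw [he0, mul_zero] at he
      exact sub_eq_zero.1 he
    -- the equilibrium conditions say that the coefficients of `e` form a vector in the kernel
    have hker : 𝒮.hankel x₀ m s *ᵥ (fun j : Fin s => e.coeff j) = 0 := by
      ext i
      have h5 := h4 i
      have h6 : 𝒮.obs (a - b) ᵥ* 𝒮.A ^ (i : ℕ) =
          ∑ j ∈ Finset.range s, e.coeff j • 𝒮.obs (X ^ (m + j + i)) := by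
        have h7 : 𝒮.obs (a - b) ᵥ* 𝒮.A ^ (i : ℕ) = 𝒮.obs e ᵥ* aeval 𝒮.A (X ^ (m + i) : k[X]) := by
          rw [← obs_mul, he]
          have : 𝒮.A ^ (i : ℕ) = aeval 𝒮.A (X ^ (i : ℕ) : k[X]) := by simp
          rw [this, ← obs_mul]
          congr 1
          ring
        rw [h7, 𝒮.obs_eq_sum e hes, Matrix.sum_vecMul]
        refine Finset.sum_congr rfl fun j _ => ?_
        rw [smul_vecMul, ← obs_mul]
        congr 2
        ring
      rw [h6, Finset.sum_range, sum_dotProduct] at h5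
      simp only [smul_dotProduct, smul_eq_mul] at h5
      rw [mulVec, dotProduct, Pi.zero_apply, ← h5]
      refine Finset.sum_congr rfl fun j _ => ?_
      rw [hankel, Matrix.of_apply, mul_comm]
    have hz : (fun j : Fin s => e.coeff j) = 0 := by
      by_contra hne
      exact hH (Matrix.exists_mulVec_eq_zero_iff.1 ⟨_, hne, hker⟩)
    have he0 : e = 0 := by
      ext j
      rcases lt_or_ge j s with hj | hj
      · exact congr_fun hz ⟨j, hj⟩
      · rw [coeff_zero, coeff_eq_zero_of_natDegree_lt (by omega)]
    rw [he0, mul_zero] at he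
    exact sub_eq_zero.1 he
  subst hab
  have h8 : ∑ i, op (𝒮.resp (some i) a - 𝒯.resp (some i) a) (u i) +
      ((𝒮.resp none a).coeff 0 - (𝒯.resp none a).coeff 0) • unitSeq k = 0 := by
    simp only [op_sub, Finset.sum_sub_distrib, sub_smul]
    rw [e1] at e2
    rw [← sub_eq_zero] at e2
    rw [← e2]
    abel
  have h9 := hu _ _ (fun i => (natDegree_sub_le _ _).trans
    (max_le ((hdegS i).trans (by omega)) ((hdegT i).trans (by omega)))) h8
  refine ⟨rfl, fun i => sub_eq_zero.1 (h9 i), ?_⟩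
  have h10 := congr_fun h8 0
  simp only [h9, op_zero, Finset.sum_const_zero, zero_add, unitSeq, Pi.smul_apply,
    Pi.single_eq_same, smul_eq_mul, mul_one, Pi.zero_apply] at h10
  exact sub_eq_zero.1 h10

end Field
end StateSpace
end LinearIdent

namespace LinearIdent
open Polynomial Matrix

/-! ### The annihilator of the output row and the Hankel matrix -/

namespace StateSpace

variable {K ι : Type*} [Field K] [Fintype ι] [DecidableEq ι]

/-- The annihilator of `C` under the action of `A` is generated by one monic polynomial. -/
lemma exists_monic_annihilator {J : Type*} (𝒮 : StateSpace K ι J) :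
    ∃ a : K[X], a.Monic ∧ ∀ f, 𝒮.obs f = 0 ↔ a ∣ f := by
  let I : Ideal K[X] :=
    { carrier := {f | 𝒮.obs f = 0}
      add_mem' := fun {f g} hf hg => by
        change 𝒮.obs (f + g) = 0
        rw [obs_add, show 𝒮.obs f = 0 from hf, show 𝒮.obs g = 0 from hg, add_zero]
      zero_mem' := by simp [obs]
      smul_mem' := fun c f hf => by
        change 𝒮.obs (c * f) = 0
        rw [mul_comm, obs_mul, show 𝒮.obs f = 0 from hf, zero_vecMul] }
  have hI : ∀ f, f ∈ I ↔ 𝒮.obs f = 0 := fun f => Iff.rfl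
  have hχ : 𝒮.A.charpoly ∈ I := 𝒮.obs_charpoly
  set g := Submodule.IsPrincipal.generator I
  have hg : ∀ f, f ∈ I ↔ g ∣ f := fun f => Submodule.IsPrincipal.mem_iff_generator_dvd I
  have hg0 : g ≠ 0 := by
    intro h0
    rw [hg, h0, zero_dvd_iff] at hχ
    exact 𝒮.A.charpoly_monic.ne_zero hχ
  refine ⟨g * Polynomial.C g.leadingCoeff⁻¹, monic_mul_leadingCoeff_inv hg0, fun f => ?_⟩
  rw [← hI, hg, (isUnit_C.2 (isUnit_iff_ne_zero.2
    (inv_ne_zero (leadingCoeff_ne_zero.2 hg0)))).mul_right_dvd]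

variable {κ : Type*} {𝒮 : StateSpace K ι (Option κ)}

/-- Linearly independent rows take arbitrary values. -/
lemma exists_obs_dotProduct_eq {m s : ℕ}
    (h : ∀ c : K[X], c.degree < s → 𝒮.obs (X ^ m * c) = 0 → c = 0) (t : ℕ → K) :
    ∃ x, ∀ i < s, 𝒮.obs (X ^ (m + i)) ⬝ᵥ x = t i := by
  let T : (ι → K) →ₗ[K] (Fin s → K) :=
    (Matrix.of fun i : Fin s => 𝒮.obs (X ^ (m + (i : ℕ)))).mulVecLin
  suffices hT : LinearMap.range T = ⊤ by
    obtain ⟨x, hx⟩ := LinearMap.range_eq_top.1 hT fun i => t i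
    exact ⟨x, fun i hi => congr_fun hx ⟨i, hi⟩⟩
  by_contra hT
  obtain ⟨f, hf0, hf⟩ := Submodule.exists_le_ker_of_lt_top _ (lt_top_iff_ne_top.2 hT)
  let c : Fin s → K := fun i => f (Pi.single i 1)
  have hfc : ∀ z, f z = ∑ i, c i * z i := by
    intro z
    conv_lhs => rw [pi_eq_sum_univ' z]
    simp [c, mul_comm]
  let p : K[X] := ∑ i : Fin s, monomial (i : ℕ) (c i)
  have hp : p.degree < s := by
    refine (degree_sum_le _ _).trans_lt ((Finset.sup_lt_iff (WithBot.bot_lt_coe s)).2 ?_)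
    intro i _
    exact (degree_monomial_le _ _).trans_lt (Nat.cast_lt.2 i.2)
  have hobs : 𝒮.obs (X ^ m * p) = ∑ i : Fin s, c i • 𝒮.obs (X ^ (m + (i : ℕ))) := by
    have : X ^ m * p = ∑ i : Fin s, c i • X ^ (m + (i : ℕ)) := by
      simp only [p, Finset.mul_sum]
      refine Finset.sum_congr rfl fun i _ => ?_
      rw [← smul_X_eq_monomial, mul_smul_comm, pow_add]
    rw [this]
    simp only [← obs_smul]
    exact map_sum (AddMonoidHom.mk' 𝒮.obs 𝒮.obs_add) _ _
  have hp0 : p = 0 := by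
    refine h p hp ?_
    rw [hobs]
    refine dotProduct_eq_zero_iff.1 fun x => ?_
    have h1 : f (T x) = 0 := hf ⟨x, rfl⟩
    rw [hfc] at h1
    rw [sum_dotProduct, ← h1]
    refine Finset.sum_congr rfl fun i _ => ?_
    rw [smul_dotProduct, smul_eq_mul]
    rfl
  refine hf0 (LinearMap.ext fun z => ?_)
  rw [hfc]
  refine Finset.sum_eq_zero fun i _ => ?_
  have : p.coeff i = c i := by
    simp only [p, finsetSum_coeff, coeff_monomial]
    rw [Finset.sum_eq_single i] <;> simp +contextual [Fin.val_inj]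
  rw [← this, hp0, coeff_zero, zero_mul]

/-- A Hankel matrix that starts with an impulse is nonsingular. -/
lemma det_hankel_ne_zero {s : ℕ} {z : ℕ → K} (hz : ∀ i < s, z i = if i + 1 = s then 1 else 0) :
    (Matrix.of fun i j : Fin s => z (j + i)).det ≠ 0 := by
  intro h0
  obtain ⟨v, hv, hMv⟩ := Matrix.exists_mulVec_eq_zero_iff.2 h0
  apply hv
  -- the `i`-th equation determines the entry `s - 1 - i` from the entries after it
  have key : ∀ i < s, ∀ j : Fin s, (j : ℕ) + i + 1 = s → v j = 0 := by
    intro i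
    induction i using Nat.strong_induction_on with
    | _ i ih =>
      intro hi j hj
      have h1 := congr_fun hMv ⟨i, hi⟩
      rw [mulVec, dotProduct, Finset.sum_eq_single j] at h1
      · simpa [hz (j + i) (by omega), hj] using h1
      · intro q _ hq
        have hq' : (q : ℕ) ≠ j := fun h => hq (Fin.ext h)
        rcases lt_or_gt_of_ne hq' with h2 | h2
        · simp [hz (q + i) (by omega), show (q : ℕ) + i + 1 ≠ s by omega]
        · rw [ih (s - 1 - q) (by omega) (by omega) q (by omega), mul_zero]
      · simp
  ext j
  exact key (s - 1 - j) (by omega) j (by omega)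

/-- Over the field of definition, the Hankel matrix of the derivative of the free response is
nonsingular for some initial state, after the powers of `X` are removed from the annihilator. The
initial state is chosen so that the derivatives start with an impulse. -/
lemma exists_det_hankel_ne_zero {a : K[X]} (ha : a.Monic) (hmin : ∀ f, 𝒮.obs f = 0 ↔ a ∣ f) :
    ∃ m s, a.natDegree = m + s ∧ X ^ m ∣ a ∧ ∃ x₀, (𝒮.hankel x₀ m s).det ≠ 0 := by
  obtain ⟨b, hab, hXb⟩ := exists_eq_pow_rootMultiplicity_mul_and_not_dvd a ha.ne_zero 0
  rw [Polynomial.C_0, sub_zero] at hab hXb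
  set m := rootMultiplicity 0 a
  have hb0 : b ≠ 0 := by rintro rfl; exact hXb (dvd_zero _)
  refine ⟨m, b.natDegree, ?_, ⟨b, hab⟩, ?_⟩
  · rw [hab, natDegree_mul (pow_ne_zero _ X_ne_zero) hb0, natDegree_X_pow]
  -- the rows `C A ^ (m + 1 + i)` are independent, as `X` does not divide `b`
  have hind : ∀ c : K[X], c.degree < b.natDegree → 𝒮.obs (X ^ (m + 1) * c) = 0 → c = 0 := by
    intro c hc h0
    rw [hmin, hab, pow_succ, mul_assoc] at h0
    obtain ⟨d, hd⟩ := (mul_dvd_mul_iff_left (pow_ne_zero m (X_ne_zero (R := K)))).1 h0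
    have hXd : X ∣ d := (prime_X.dvd_or_dvd (Dvd.intro _ hd : X ∣ b * d)).resolve_left hXb
    obtain ⟨e, rfl⟩ := hXd
    have h1 : b ∣ c := ⟨e, mul_left_cancel₀ X_ne_zero (by rw [hd]; ring)⟩
    by_contra hc0
    have := degree_le_of_dvd h1 hc0
    rw [degree_eq_natDegree hb0] at this
    exact absurd hc (not_lt.2 this)
  set β : ι → K := fun i => 𝒮.B i none
  obtain ⟨x, hx⟩ := exists_obs_dotProduct_eq hind fun i =>
    (if i + 1 = b.natDegree then 1 else 0) - 𝒮.obs (X ^ (m + i)) ⬝ᵥ β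
  refine ⟨x, ?_⟩
  have := det_hankel_ne_zero (s := b.natDegree)
    (z := fun i => 𝒮.obs (X ^ (m + i)) ⬝ᵥ (𝒮.A *ᵥ x + β)) (fun i hi => by
      have h1 := hx i hi
      rw [dotProduct_add, dotProduct_mulVec, ← obs_mul_X, ← pow_succ,
        show m + i + 1 = m + 1 + i by ring, h1, sub_add_cancel])
  simp only [← add_assoc] at this
  exact this

end StateSpace
end LinearIdent

namespace LinearIdent

/-! ### Polynomials of degree at most one -/

section AffinePolynomial

open MvPolynomial

variable {V K : Type*} [CommRing K]

lemma eq_zero_or_single_of_mem_support {F : MvPolynomial V K} (hF : F.totalDegree ≤ 1)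
    {e : V →₀ ℕ} (he : e ∈ F.support) : e = 0 ∨ ∃ v, e = Finsupp.single v 1 := by
  classical
  have h1 : Multiset.card e.toMultiset ≤ 1 := by
    rw [Finsupp.card_toMultiset]
    exact (le_totalDegree he).trans hF
  rcases Nat.le_one_iff_eq_zero_or_eq_one.1 h1 with h | h
  · rw [Multiset.card_eq_zero, Finsupp.toMultiset_eq_iff] at h
    exact Or.inl (by simpa using h)
  · obtain ⟨v, hv⟩ := Multiset.card_eq_one.1 h
    rw [Finsupp.toMultiset_eq_iff, Multiset.toFinsupp_singleton] at hv
    exact Or.inr ⟨v, hv⟩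

lemma ext_of_totalDegree_le_one {F G : MvPolynomial V K} (hF : F.totalDegree ≤ 1)
    (hG : G.totalDegree ≤ 1) (h0 : F.coeff 0 = G.coeff 0)
    (h1 : ∀ v, F.coeff (Finsupp.single v 1) = G.coeff (Finsupp.single v 1)) : F = G := by
  classical
  ext e
  by_cases he : e ∈ F.support ∪ G.support
  · have : e = 0 ∨ ∃ v, e = Finsupp.single v 1 := by
      rcases Finset.mem_union.1 he with h | h
      · exact eq_zero_or_single_of_mem_support hF h
      · exact eq_zero_or_single_of_mem_support hG h
    rcases this with rfl | ⟨v, rfl⟩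
    · exact h0
    · exact h1 v
  · rw [Finset.mem_union, not_or, notMem_support_iff, notMem_support_iff] at he
    rw [he.1, he.2]

lemma sum_support_of_totalDegree_le_one [Fintype V] {N : Type*} [AddCommMonoid N]
    {F : MvPolynomial V K} (hF : F.totalDegree ≤ 1) (φ : (V →₀ ℕ) → N)
    (hφ : ∀ e, F.coeff e = 0 → φ e = 0) :
    ∑ e ∈ F.support, φ e = φ 0 + ∑ v, φ (Finsupp.single v 1) := by
  classical
  let s : Option V → (V →₀ ℕ) := fun o => o.elim 0 fun v => Finsupp.single v 1
  have hs : Function.Injective s := by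
    rintro (_ | v) (_ | v') h
    · rfl
    · exact absurd h.symm (by simp [s])
    · exact absurd h (by simp [s])
    · rw [(Finsupp.single_left_inj one_ne_zero).1 h]
  have : ∑ e ∈ F.support, φ e = ∑ e ∈ Finset.univ.image s, φ e := by
    refine Finset.sum_subset (fun e he => ?_) fun e _ he => hφ e (notMem_support_iff.1 he)
    rcases eq_zero_or_single_of_mem_support hF he with rfl | ⟨v, rfl⟩
    · exact Finset.mem_image.2 ⟨none, Finset.mem_univ _, rfl⟩
    · exact Finset.mem_image.2 ⟨some v, Finset.mem_univ _, rfl⟩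
  rw [this, Finset.sum_image hs.injOn, Fintype.sum_option]
  rfl

lemma aeval_of_totalDegree_le_one [Fintype V] {R : Type*} [CommRing R] [Algebra K R]
    {F : MvPolynomial V K} (hF : F.totalDegree ≤ 1) (z : V → R) :
    aeval z F = F.coeff 0 • 1 + ∑ v, F.coeff (Finsupp.single v 1) • z v := by
  rw [aeval_def, eval₂_eq, sum_support_of_totalDegree_le_one hF _ (by simp +contextual)]
  simp [Algebra.smul_def]

end AffinePolynomial

/-! ### Differential operators applied to sequences of variables -/

section OpCoeff

open Polynomial

variable {R M N : Type*} [CommRing R] [AddCommGroup M] [Module R M] [AddCommGroup N] [Module R N]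

lemma map_op (φ : M →ₗ[R] N) (f : R[X]) (w : ℕ → M) (j : ℕ) :
    φ (op f w j) = op f (fun i => φ (w i)) j := by
  rw [op_apply, op_apply, Polynomial.sum, Polynomial.sum, map_sum]
  simp

lemma op_single (f : R[X]) (t : ℕ) : op f (Pi.single t (1 : R) : ℕ → R) 0 = f.coeff t := by
  rw [op_apply]
  simp +contextual [Polynomial.sum, Pi.single_apply, eq_comm]

variable {V : Type*}

lemma coeff_op_X_self {s : ℕ → V} (hs : Function.Injective s) (f : R[X]) (t : ℕ) :
    (op f (fun i => MvPolynomial.X (R := R) (s i)) 0).coeff (Finsupp.single (s t) 1) =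
      f.coeff t := by
  classical
  have := map_op (MvPolynomial.lcoeff R (Finsupp.single (s t) 1)) f
    (fun i => MvPolynomial.X (R := R) (s i)) 0
  rw [MvPolynomial.lcoeff_apply] at this
  rw [this, ← op_single]
  refine congrArg (fun w => op f w 0) ?_
  funext i
  simp [MvPolynomial.coeff_X, Pi.single_apply, Finsupp.single_left_inj, hs.eq_iff]

lemma coeff_op_X_of_ne {s : ℕ → V} (f : R[X]) {e : V →₀ ℕ} (he : ∀ i, e ≠ Finsupp.single (s i) 1) :
    (op f (fun i => MvPolynomial.X (R := R) (s i)) 0).coeff e = 0 := by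
  classical
  have := map_op (MvPolynomial.lcoeff R e) f (fun i => MvPolynomial.X (R := R) (s i)) 0
  rw [MvPolynomial.lcoeff_apply] at this
  rw [this, op_apply]
  simp [MvPolynomial.coeff_X, fun i => (he i).symm, Polynomial.sum]

lemma op_unitSeq_zero (f : R[X]) :
    op f (unitSeq (MvPolynomial V R)) 0 = MvPolynomial.C (f.coeff 0) := by
  rw [op_apply]
  simp +contextual [Polynomial.sum, unitSeq, Pi.single_apply, MvPolynomial.smul_eq_C_mul, eq_comm]
  exact fun h => by rw [← h, map_zero]

lemma totalDegree_op_X_le (s : ℕ → V) (f : R[X]) :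
    (op f (fun i => MvPolynomial.X (R := R) (s i)) 0).totalDegree ≤ 1 := by
  rcases subsingleton_or_nontrivial R with hR | hR
  · rw [Subsingleton.elim (op f _ 0) 0, MvPolynomial.totalDegree_zero]
    exact zero_le_one
  rw [op_apply, Polynomial.sum]
  refine MvPolynomial.totalDegree_finsetSum_le fun i _ => ?_
  exact (MvPolynomial.totalDegree_smul_le _ _).trans (MvPolynomial.totalDegree_X _).le

/-- The coefficients of a polynomial at a sequence of its variables, as a univariate polynomial. -/
lemma exists_coeff_eq (q : MvPolynomial V R) {s : ℕ → V} (hs : Function.Injective s) :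
    ∃ f : R[X], ∀ i, f.coeff i = q.coeff (Finsupp.single (s i) 1) := by
  have hfin : {i | q.coeff (Finsupp.single (s i) 1) ≠ 0}.Finite := by
    refine Set.Finite.of_finite_image (f := fun i => Finsupp.single (s i) 1)
      (q.support.finite_toSet.subset ?_) ?_
    · rintro _ ⟨i, hi, rfl⟩
      exact MvPolynomial.mem_support_iff.2 hi
    · intro i _ j _ hij
      exact hs ((Finsupp.single_left_inj one_ne_zero).1 hij)
  refine ⟨∑ i ∈ hfin.toFinset, monomial i (q.coeff (Finsupp.single (s i) 1)), fun i => ?_⟩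
  rw [finsetSum_coeff]
  simp only [coeff_monomial, Finset.sum_ite_eq', Set.Finite.mem_toFinset, Set.mem_ofPred_eq]
  split_ifs with h
  · rfl
  · simpa [eq_comm] using h

end OpCoeff
end LinearIdent

namespace LinearIdent
open Polynomial

/-! ### Input-output equations as differential polynomials -/

namespace LinearSystem

variable {n κ l : ℕ} (S : LinearSystem n 1 κ l)

/-- The coefficient matrices of a linear system with one output; the constant terms are the
coefficients of the additional input `none`, which is the constant function `1`. -/
def toStateSpace : StateSpace (ParamField l) (Fin n) (Option (Fin κ)) where
  A i j := (S.f i).coeff (Finsupp.single (Sum.inl j) 1)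
  B i o := o.elim ((S.f i).coeff 0) fun k => (S.f i).coeff (Finsupp.single (Sum.inr k) 1)
  C j := (S.g 0).coeff (Finsupp.single (Sum.inl j) 1)
  D o := o.elim ((S.g 0).coeff 0) fun k => (S.g 0).coeff (Finsupp.single (Sum.inr k) 1)

/-- The sequences of the derivatives of the inputs and of the constant function `1`, as
differential polynomials in variables among which `s k` are the inputs. -/
def inputVar {V K : Type} [Field K] (s : Fin κ → V) : Option (Fin κ) → ℕ → DiffPoly K V
  | none => unitSeq _
  | some k => fun t => MvPolynomial.X (s k, t)

lemma diffDeriv_inputVar {V K : Type} [Field K] (s : Fin κ → V) (o : Option (Fin κ)) (t : ℕ) :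
    diffDeriv K V (inputVar s o t) = inputVar s o (t + 1) := by
  rcases o with _ | k
  · rcases t with _ | t <;> simp [inputVar, unitSeq]
  · simp [inputVar, diffDeriv, MvPolynomial.mkDerivation_X]

/-- The differential polynomial `a(d/dt) y - ∑ resp(a)(d/dt) w`. If `C a(A) = 0`, it lies in the
differential ideal of the system. -/
def ioPoly (a : (ParamField l)[X]) : DiffPoly (ParamField l) (Fin 1 ⊕ Fin κ) :=
  op a (fun i => MvPolynomial.X (Sum.inl 0, i)) 0 -
    ∑ o, op (S.toStateSpace.resp o a) (inputVar Sum.inr o) 0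

lemma injective_pair {V : Type} (v : V) : Function.Injective fun i : ℕ => (v, i) :=
  Prod.mk_right_injective v

section AffineForm

variable (a : (ParamField l)[X]) (b : Option (Fin κ) → (ParamField l)[X])

/-- The differential polynomial `a(d/dt) y + ∑ b(d/dt) w`; the constant function `1` contributes
only the constant coefficient of `b none`. Every differential polynomial of degree at most one in
the output and the inputs has this form, see `exists_eq_affineForm`. -/
def affineForm : DiffPoly (ParamField l) (Fin 1 ⊕ Fin κ) :=
  op a (fun i => MvPolynomial.X (Sum.inl 0, i)) 0 + ∑ o, op (b o) (inputVar Sum.inr o) 0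

lemma coeff_affineForm_out (i : ℕ) :
    (affineForm a b).coeff (Finsupp.single (Sum.inl 0, i) 1) = a.coeff i := by
  rw [affineForm, Fintype.sum_option, MvPolynomial.coeff_add, MvPolynomial.coeff_add,
    coeff_op_X_self (s := fun i => ((Sum.inl 0 : Fin 1 ⊕ Fin κ), i)) (injective_pair _),
    MvPolynomial.coeff_sum, Finset.sum_eq_zero, add_zero, inputVar, op_unitSeq_zero,
    MvPolynomial.coeff_C, if_neg, add_zero]
  · intro h
    have := congr($h (Sum.inl 0, i))
    simp at this
  · intro k _
    exact coeff_op_X_of_ne (s := fun t => ((Sum.inr k : Fin 1 ⊕ Fin κ), t)) _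
      (fun t h => by simp [Finsupp.single_left_inj] at h)

lemma coeff_affineForm_input (k : Fin κ) (t : ℕ) :
    (affineForm a b).coeff (Finsupp.single (Sum.inr k, t) 1) = (b (some k)).coeff t := by
  rw [affineForm, Fintype.sum_option, MvPolynomial.coeff_add, MvPolynomial.coeff_add,
    coeff_op_X_of_ne (s := fun i => ((Sum.inl 0 : Fin 1 ⊕ Fin κ), i)) _
      (fun t h => by simp [Finsupp.single_left_inj] at h), zero_add,
    MvPolynomial.coeff_sum, Finset.sum_eq_single k, inputVar, op_unitSeq_zero,
    MvPolynomial.coeff_C, if_neg, zero_add]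
  · exact coeff_op_X_self (s := fun t => ((Sum.inr k : Fin 1 ⊕ Fin κ), t)) (injective_pair _) _ _
  · intro h
    have := congr($h (Sum.inr k, t))
    simp at this
  · intro k' _ hk
    exact coeff_op_X_of_ne (s := fun t => ((Sum.inr k' : Fin 1 ⊕ Fin κ), t)) _
      (fun t h => by simp [Finsupp.single_left_inj, hk.symm] at h)
  · simp

lemma coeff_affineForm_zero : (affineForm a b).coeff 0 = (b none).coeff 0 := by
  rw [affineForm, Fintype.sum_option, MvPolynomial.coeff_add, MvPolynomial.coeff_add,
    coeff_op_X_of_ne (s := fun i => ((Sum.inl 0 : Fin 1 ⊕ Fin κ), i)) _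
      (fun t h => one_ne_zero (Finsupp.single_eq_zero.1 h.symm)), zero_add,
    MvPolynomial.coeff_sum, Finset.sum_eq_zero, add_zero, inputVar, op_unitSeq_zero,
    MvPolynomial.coeff_C, if_pos rfl]
  intro k _
  exact coeff_op_X_of_ne (s := fun t => ((Sum.inr k : Fin 1 ⊕ Fin κ), t)) _
      (fun t h => one_ne_zero (Finsupp.single_eq_zero.1 h.symm))

lemma totalDegree_affineForm_le : (affineForm a b).totalDegree ≤ 1 := by
  refine (MvPolynomial.totalDegree_add _ _).trans (max_le (totalDegree_op_X_le _ _) ?_)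
  refine MvPolynomial.totalDegree_finsetSum_le fun o _ => ?_
  rcases o with _ | k
  · rw [inputVar, op_unitSeq_zero, MvPolynomial.totalDegree_C]
    exact zero_le_one
  · exact totalDegree_op_X_le _ _

lemma diffOrd_affineForm : diffOrd (Sum.inl 0) (affineForm a b) = a.degree := by
  have hmem : ∀ i, ((Sum.inl 0, i) : (Fin 1 ⊕ Fin κ) × ℕ) ∈ (affineForm a b).vars ↔
      a.coeff i ≠ 0 := by
    intro i
    rw [MvPolynomial.mem_vars_iff_mem_support, ← coeff_affineForm_out a b i]
    constructor
    · rintro ⟨e, he, hie⟩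
      rcases eq_zero_or_single_of_mem_support (totalDegree_affineForm_le a b) he with rfl | ⟨v, rfl⟩
      · simp at hie
      · rw [Finsupp.support_single _ one_ne_zero, Finset.mem_singleton] at hie
        rw [hie]
        exact MvPolynomial.mem_support_iff.1 he
    · intro h
      exact ⟨_, MvPolynomial.mem_support_iff.2 h, by simp⟩
  apply le_antisymm
  · refine Finset.sup_le fun v hv => ?_
    obtain ⟨⟨w, i⟩, rfl⟩ : ∃ w, w = v := ⟨v, rfl⟩
    simp only [Finset.mem_filter] at hv
    obtain ⟨hv, rfl⟩ := hv
    exact le_degree_of_ne_zero ((hmem i).1 hv)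
  · refine Finset.max_le fun i hi => ?_
    refine Finset.le_sup (f := fun v : (Fin 1 ⊕ Fin κ) × ℕ => (v.2 : WithBot ℕ))
      (b := (Sum.inl 0, i)) ?_
    simp only [Finset.mem_filter]
    exact ⟨(hmem i).2 (mem_support_iff.1 hi), trivial⟩

lemma exists_eq_affineForm {q : DiffPoly (ParamField l) (Fin 1 ⊕ Fin κ)}
    (hq : q.totalDegree ≤ 1) : ∃ a b, q = affineForm a b := by
  obtain ⟨a, ha⟩ := exists_coeff_eq q (s := fun i => (Sum.inl 0, i)) (injective_pair _)
  choose b hb using fun k => exists_coeff_eq q (s := fun i => (Sum.inr k, i)) (injective_pair _)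
  refine ⟨a, fun o => o.elim (Polynomial.C (q.coeff 0)) b,
    ext_of_totalDegree_le_one hq (totalDegree_affineForm_le _ _) ?_ ?_⟩
  · rw [coeff_affineForm_zero]
    simp
  · rintro ⟨j | k, i⟩
    · rw [Subsingleton.elim j 0, coeff_affineForm_out, ha]
    · rw [coeff_affineForm_input]
      exact (hb k i).symm

end AffineForm

lemma ioPoly_eq_affineForm (a : (ParamField l)[X]) :
    S.ioPoly a = affineForm a fun o => -S.toStateSpace.resp o a := by
  rw [ioPoly, affineForm, sub_eq_add_neg, ← Finset.sum_neg_distrib]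
  congr 1
  refine Finset.sum_congr rfl fun o _ => ?_
  rw [← zero_sub (S.toStateSpace.resp o a), op_sub, op_zero, zero_sub, Pi.neg_apply]

/-! ### The differential ideal of the system -/

lemma aeval_f {R : Type*} [CommRing R] [Algebra (ParamField l) R] (z : Fin n ⊕ Fin κ → R)
    (i : Fin n) {w : Option (Fin κ) → R} (hw : w none = 1)
    (hw' : ∀ k, w (some k) = z (Sum.inr k)) :
    MvPolynomial.aeval z (S.f i) =
      ∑ j, S.toStateSpace.A i j • z (Sum.inl j) + ∑ o, S.toStateSpace.B i o • w o := by
  rw [aeval_of_totalDegree_le_one (S.degree_f i), Fintype.sum_sum_type, Fintype.sum_option, hw]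
  simp only [hw', toStateSpace, Option.elim]
  abel

lemma aeval_g {R : Type*} [CommRing R] [Algebra (ParamField l) R] (z : Fin n ⊕ Fin κ → R)
    {w : Option (Fin κ) → R} (hw : w none = 1)
    (hw' : ∀ k, w (some k) = z (Sum.inr k)) :
    MvPolynomial.aeval z (S.g 0) =
      ∑ j, S.toStateSpace.C j • z (Sum.inl j) + ∑ o, S.toStateSpace.D o • w o := by
  rw [aeval_of_totalDegree_le_one (S.degree_g 0), Fintype.sum_sum_type, Fintype.sum_option, hw]
  simp only [hw', toStateSpace, Option.elim]
  abel

/-- The variables of `ℂ(μ){x, y, u}`. -/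
abbrev Var (n κ : ℕ) : Type := Fin n ⊕ Fin 1 ⊕ Fin κ

lemma toDiff_f (i : Fin n) : toDiff (m := 1) (S.f i) =
    ∑ j, S.toStateSpace.A i j • MvPolynomial.X (Sum.inl j, 0) +
      ∑ o, S.toStateSpace.B i o • inputVar (fun k => Sum.inr (Sum.inr k)) o 0 := by
  rw [toDiff, MvPolynomial.rename_eq_aeval, S.aeval_f _ i (w := fun o =>
    inputVar (fun k => (Sum.inr (Sum.inr k) : Var n κ)) o 0)]
  · rfl
  · simp [inputVar, unitSeq]
  · intro k
    rfl

lemma toDiff_g : toDiff (m := 1) (S.g 0) =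
    ∑ j, S.toStateSpace.C j • MvPolynomial.X (Sum.inl j, 0) +
      ∑ o, S.toStateSpace.D o • inputVar (fun k => Sum.inr (Sum.inr k)) o 0 := by
  rw [toDiff, MvPolynomial.rename_eq_aeval, S.aeval_g _ (w := fun o =>
    inputVar (fun k => (Sum.inr (Sum.inr k) : Var n κ)) o 0)]
  · rfl
  · simp [inputVar, unitSeq]
  · intro k
    rfl

lemma diffDeriv_mem_ideal {p : DiffPoly (ParamField l) (Var n κ)} (hp : p ∈ S.ideal) :
    diffDeriv (ParamField l) (Var n κ) p ∈ S.ideal := by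
  rw [ideal, diffIdeal, Submodule.mem_sInf] at hp ⊢
  exact fun I hI => hI.2 _ (hp I hI)

lemma mem_ideal_of_mem {p : DiffPoly (ParamField l) (Var n κ)}
    (hp : p ∈ ((Set.range fun i : Fin n => MvPolynomial.X (Sum.inl i, 1) - toDiff (S.f i)) ∪
      Set.range fun j : Fin 1 => MvPolynomial.X (Sum.inr (Sum.inl j), 0) - toDiff (S.g j) :
        Set (DiffPoly (ParamField l) (Var n κ)))) : p ∈ S.ideal := by
  rw [ideal, diffIdeal, Submodule.mem_sInf]
  exact fun I hI => hI.1 hp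

/-- Modulo the differential ideal, the variables form a trajectory of the system. -/
lemma isTraj_quotient : S.toStateSpace.IsTraj
    (fun v j => Ideal.Quotient.mk S.ideal (MvPolynomial.X (Sum.inl v, j)))
    (fun o j => Ideal.Quotient.mk S.ideal (inputVar (fun k => Sum.inr (Sum.inr k)) o j))
    (fun j => Ideal.Quotient.mk S.ideal (MvPolynomial.X (Sum.inr (Sum.inl 0), j))) := by
  have hsmul : ∀ (c : ParamField l) (p : DiffPoly (ParamField l) (Var n κ)),
      c • Ideal.Quotient.mk S.ideal p = Ideal.Quotient.mk S.ideal (c • p) := fun _ _ => rfl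
  constructor
  · intro v j
    simp only [hsmul, ← map_sum, ← map_add]
    rw [Ideal.Quotient.eq]
    induction j with
    | zero =>
      rw [← toDiff_f]
      exact S.mem_ideal_of_mem (Or.inl ⟨v, rfl⟩)
    | succ j ih =>
      have := S.diffDeriv_mem_ideal ih
      simp only [map_sub, map_add, map_sum, Derivation.map_smul, diffDeriv_inputVar] at this
      simpa only [diffDeriv, MvPolynomial.mkDerivation_X] using this
  · intro j
    simp only [hsmul, ← map_sum, ← map_add]
    rw [Ideal.Quotient.eq]
    induction j with
    | zero =>
      rw [← toDiff_g]
      exact S.mem_ideal_of_mem (Or.inr ⟨0, rfl⟩)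
    | succ j ih =>
      have := S.diffDeriv_mem_ideal ih
      simp only [map_sub, map_add, map_sum, Derivation.map_smul, diffDeriv_inputVar] at this
      simpa only [diffDeriv, MvPolynomial.mkDerivation_X] using this

lemma map_affineForm {R : Type*} [CommRing R] [Algebra (ParamField l) R]
    (φ : DiffPoly (ParamField l) (Fin 1 ⊕ Fin κ) →ₗ[ParamField l] R)
    (a : (ParamField l)[X]) (b : Option (Fin κ) → (ParamField l)[X]) :
    φ (affineForm a b) = op a (fun i => φ (MvPolynomial.X (Sum.inl 0, i))) 0 +
      ∑ o, op (b o) (fun t => φ (inputVar Sum.inr o t)) 0 := by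
  rw [affineForm, map_add, map_sum, map_op]
  simp only [map_op]

lemma inclYU_inputVar (o : Option (Fin κ)) (t : ℕ) :
    inclYU (n := n) (inputVar (K := ParamField l) (Sum.inr : Fin κ → Fin 1 ⊕ Fin κ) o t) =
      inputVar (fun k => Sum.inr (Sum.inr k)) o t := by
  rcases o with _ | k
  · rcases t with _ | t <;> simp [inputVar, unitSeq, inclYU]
  · simp [inputVar, inclYU]

lemma inclYU_ioPoly_mem {a : (ParamField l)[X]} (ha : S.toStateSpace.obs a = 0) :
    inclYU (S.ioPoly a) ∈ S.ideal := by
  rw [← Ideal.Quotient.eq_zero_iff_mem]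
  let φ : DiffPoly (ParamField l) (Fin 1 ⊕ Fin κ) →ₗ[ParamField l]
      DiffPoly (ParamField l) (Var n κ) ⧸ S.ideal :=
    (Ideal.Quotient.mkₐ (ParamField l) S.ideal).toLinearMap.comp
      (MvPolynomial.rename fun a : (Fin 1 ⊕ Fin κ) × ℕ => (Sum.inr a.1, a.2)).toLinearMap
  have hφ : ∀ p, φ p = Ideal.Quotient.mk S.ideal (inclYU p) := fun _ => rfl
  rw [← hφ, ioPoly_eq_affineForm, map_affineForm]
  simp only [hφ, inclYU_inputVar]
  have h1 := congr_fun (S.isTraj_quotient.op_out_of_obs_eq_zero ha) 0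
  have h2 : ∀ i, inclYU (n := n) (MvPolynomial.X (R := ParamField l)
      ((Sum.inl 0 : Fin 1 ⊕ Fin κ), i)) = MvPolynomial.X (Sum.inr (Sum.inl 0), i) := by
    intro i
    simp [inclYU]
  simp only [h2]
  rw [h1, Finset.sum_apply, ← Finset.sum_add_distrib]
  refine Finset.sum_eq_zero fun o _ => ?_
  rw [← Pi.add_apply, ← op_add, add_neg_cancel, op_zero, Pi.zero_apply]

/-! ### Reduction modulo the differential ideal -/

/-- The ring `ℂ(μ){u}[x]` of the normal forms modulo the differential ideal. -/
abbrev NormalForm (n κ l : ℕ) : Type := MvPolynomial (Fin n ⊕ Fin κ × ℕ) (ParamField l)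

/-- The inputs and the constant function `1` in the ring of normal forms. -/
def nfInput : Option (Fin κ) → ℕ → NormalForm n κ l
  | none => unitSeq _
  | some k => fun t => MvPolynomial.X (Sum.inr (k, t))

/-- The derivation along the solutions on the ring of normal forms. -/
def nfDeriv : Derivation (ParamField l) (NormalForm n κ l) (NormalForm n κ l) :=
  MvPolynomial.mkDerivation _ (Sum.elim
    (fun v => ∑ j, S.toStateSpace.A v j • MvPolynomial.X (Sum.inl j) +
      ∑ o, S.toStateSpace.B v o • nfInput o 0)
    fun a => MvPolynomial.X (Sum.inr (a.1, a.2 + 1)))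

lemma nfDeriv_nfInput (o : Option (Fin κ)) (t : ℕ) :
    S.nfDeriv (nfInput o t) = nfInput o (t + 1) := by
  rcases o with _ | k
  · rcases t with _ | t <;> simp [nfInput, unitSeq]
  · simp [nfInput, nfDeriv, MvPolynomial.mkDerivation_X]

/-- The derivatives of the states in normal form. -/
def nfState (v : Fin n) (j : ℕ) : NormalForm n κ l := S.nfDeriv^[j] (MvPolynomial.X (Sum.inl v))

/-- The derivatives of the output in normal form. -/
def nfOut (j : ℕ) : NormalForm n κ l := S.nfDeriv^[j]
  (∑ v, S.toStateSpace.C v • MvPolynomial.X (Sum.inl v) + ∑ o, S.toStateSpace.D o • nfInput o 0)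

lemma nfDeriv_nfState (v : Fin n) (j : ℕ) : S.nfDeriv (S.nfState v j) = S.nfState v (j + 1) := by
  rw [nfState, nfState, Function.iterate_succ_apply']

lemma nfDeriv_nfOut (j : ℕ) : S.nfDeriv (S.nfOut j) = S.nfOut (j + 1) := by
  rw [nfOut, nfOut, Function.iterate_succ_apply']

lemma isTraj_nf : S.toStateSpace.IsTraj S.nfState nfInput S.nfOut := by
  constructor
  · intro v j
    induction j with
    | zero => simp [nfState, nfDeriv, MvPolynomial.mkDerivation_X]
    | succ j ih =>
      rw [← nfDeriv_nfState, ih]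
      simp only [map_add, map_sum, Derivation.map_smul, nfDeriv_nfState, nfDeriv_nfInput]
  · intro j
    induction j with
    | zero => simp [nfState, nfOut]
    | succ j ih =>
      rw [← nfDeriv_nfOut, ih]
      simp only [map_add, map_sum, Derivation.map_smul, nfDeriv_nfState, nfDeriv_nfInput]

/-- Reduction to normal form: the derivatives of the states and of the output are expressed by the
states and the derivatives of the inputs. It commutes with the derivations and vanishes on the
differential ideal. -/
def nf : DiffPoly (ParamField l) (Var n κ) →ₐ[ParamField l] NormalForm n κ l :=
  MvPolynomial.aeval fun a => match a.1 with
    | Sum.inl v => S.nfState v a.2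
    | Sum.inr (Sum.inl _) => S.nfOut a.2
    | Sum.inr (Sum.inr k) => nfInput (some k) a.2

lemma nf_diffDeriv (p : DiffPoly (ParamField l) (Var n κ)) :
    S.nf (diffDeriv _ _ p) = S.nfDeriv (S.nf p) := by
  induction p using MvPolynomial.induction_on with
  | C c => simp [nf, diffDeriv]
  | add p q hp hq => simp only [map_add, hp, hq]
  | mul_X p a hp =>
    have hX : S.nf (diffDeriv _ _ (MvPolynomial.X a)) = S.nfDeriv (S.nf (MvPolynomial.X a)) := by
      obtain ⟨v | j | k, i⟩ := a
      · simp [nf, diffDeriv, MvPolynomial.mkDerivation_X, nfDeriv_nfState]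
      · simp [nf, diffDeriv, MvPolynomial.mkDerivation_X, nfDeriv_nfOut]
      · simp [nf, diffDeriv, MvPolynomial.mkDerivation_X, nfDeriv_nfInput]
    rw [Derivation.leibniz, map_add, map_mul, Derivation.leibniz]
    simp only [smul_eq_mul, map_mul, hp, hX]

lemma nf_inputVar (o : Option (Fin κ)) (t : ℕ) :
    S.nf (inputVar (fun k => Sum.inr (Sum.inr k)) o t) = nfInput o t := by
  rcases o with _ | k
  · rcases t with _ | t <;> simp [inputVar, nfInput, unitSeq]
  · simp [inputVar, nf]

lemma nf_eq_zero_of_mem_ideal {p : DiffPoly (ParamField l) (Var n κ)} (hp : p ∈ S.ideal) :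
    S.nf p = 0 := by
  have hle : S.ideal ≤ RingHom.ker S.nf := by
    refine sInf_le ⟨?_, fun a ha => ?_⟩
    · rintro _ (⟨i, rfl⟩ | ⟨j, rfl⟩)
      · change S.nf _ = 0
        rw [map_sub, toDiff_f, sub_eq_zero]
        simp only [map_add, map_sum, map_smul, nf_inputVar]
        simpa [nf] using S.isTraj_nf.state i 0
      · change S.nf _ = 0
        rw [Subsingleton.elim j 0, map_sub, toDiff_g, sub_eq_zero]
        simp only [map_add, map_sum, map_smul, nf_inputVar]
        simpa [nf] using S.isTraj_nf.out 0
    · rw [RingHom.mem_ker] at ha ⊢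
      rw [nf_diffDeriv, ha, map_zero]
  exact hle hp

lemma coeff_nfInput (f : (ParamField l)[X]) (o : Option (Fin κ)) (k : Fin κ) (t : ℕ) :
    (op f (nfInput (n := n) o) 0).coeff (Finsupp.single (Sum.inr (k, t)) 1) =
      if o = some k then f.coeff t else 0 := by
  rcases o with _ | k'
  · rw [nfInput, op_unitSeq_zero, MvPolynomial.coeff_C, if_neg, if_neg (by simp)]
    intro h
    have := congr($h (Sum.inr (k, t)))
    simp at this
  · by_cases hk : k' = k
    · subst hk
      rw [if_pos rfl]
      exact coeff_op_X_self (s := fun t => (Sum.inr (k', t) : Fin n ⊕ Fin κ × ℕ))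
        (fun i j h => by simpa using h) f t
    · rw [if_neg (by simpa using hk)]
      exact coeff_op_X_of_ne (s := fun t => (Sum.inr (k', t) : Fin n ⊕ Fin κ × ℕ)) f
        (fun i h => by simp [Finsupp.single_left_inj] at h; exact hk h.1.symm)

/-- The affine differential polynomials in the differential ideal are the input-output relations
that come from the annihilator of `C`: in normal form, the states occur with the coefficients
`C a(A)`. -/
lemma eq_ioPoly_of_mem {q : DiffPoly (ParamField l) (Fin 1 ⊕ Fin κ)} (hq : inclYU q ∈ S.ideal)
    (hdeg : q.totalDegree ≤ 1) :
    ∃ a, S.toStateSpace.obs a = 0 ∧ q = S.ioPoly a := by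
  obtain ⟨a, b, rfl⟩ := exists_eq_affineForm hdeg
  have h0 := S.nf_eq_zero_of_mem_ideal hq
  let φ : DiffPoly (ParamField l) (Fin 1 ⊕ Fin κ) →ₗ[ParamField l] NormalForm n κ l :=
    S.nf.toLinearMap.comp
      (MvPolynomial.rename fun a : (Fin 1 ⊕ Fin κ) × ℕ => (Sum.inr a.1, a.2)).toLinearMap
  have hφ : ∀ p, φ p = S.nf (inclYU p) := fun _ => rfl
  rw [← hφ, map_affineForm] at h0
  simp only [hφ, inclYU_inputVar, nf_inputVar] at h0
  have h2 : ∀ i, S.nf (inclYU (n := n) (MvPolynomial.X (R := ParamField l)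
      ((Sum.inl 0 : Fin 1 ⊕ Fin κ), i))) = S.nfOut i := by
    intro i
    simp [inclYU, nf]
  simp only [h2] at h0
  change op a S.nfOut 0 + ∑ o, op (b o) (nfInput o) 0 = 0 at h0
  rw [S.isTraj_nf.op_out, Pi.add_apply, Finset.sum_apply, Finset.sum_apply, add_assoc,
    ← Finset.sum_add_distrib] at h0
  simp only [← op_add_apply] at h0
  have hobs : S.toStateSpace.obs a = 0 := by
    ext v
    have h3 := congrArg (MvPolynomial.coeff (Finsupp.single (Sum.inl v) 1)) h0
    rw [MvPolynomial.coeff_add, MvPolynomial.coeff_sum, MvPolynomial.coeff_sum,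
      Finset.sum_eq_single v, Finset.sum_eq_zero, add_zero] at h3
    · simpa [nfState] using h3
    · intro o _
      rcases o with _ | k
      · rw [nfInput, op_unitSeq_zero, MvPolynomial.coeff_C, if_neg]
        intro h
        have := congr($h (Sum.inl v))
        simp at this
      · exact coeff_op_X_of_ne (s := fun t => (Sum.inr (k, t) : Fin n ⊕ Fin κ × ℕ)) _
          (fun i h => by simp [Finsupp.single_left_inj] at h)
    · intro v' _ hv
      classical
      rw [Pi.smul_apply, MvPolynomial.coeff_smul, nfState, Function.iterate_zero, id,
        MvPolynomial.coeff_X, if_neg, smul_zero]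
      rw [Finsupp.single_left_inj one_ne_zero]
      exact fun h => hv (Sum.inl_injective h)
    · simp
  refine ⟨a, hobs, ?_⟩
  rw [ioPoly_eq_affineForm]
  simp only [hobs, Pi.zero_apply, zero_smul, Finset.sum_const_zero, zero_add] at h0
  refine ext_of_totalDegree_le_one hdeg (totalDegree_affineForm_le _ _) ?_ ?_
  · rw [coeff_affineForm_zero, coeff_affineForm_zero]
    have h3 := congrArg (MvPolynomial.coeff 0) h0
    rw [MvPolynomial.coeff_sum, Fintype.sum_option, Finset.sum_eq_zero, add_zero, nfInput,
      op_unitSeq_zero, MvPolynomial.coeff_C, if_pos rfl, MvPolynomial.coeff_zero, coeff_add] at h3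
    · rw [coeff_neg]
      linear_combination h3
    · intro k _
      exact coeff_op_X_of_ne (s := fun t => (Sum.inr (k, t) : Fin n ⊕ Fin κ × ℕ)) _
          (fun i h => one_ne_zero (Finsupp.single_eq_zero.1 h.symm))
  · rintro ⟨j | k, t⟩
    · rw [Subsingleton.elim j 0, coeff_affineForm_out, coeff_affineForm_out]
    · rw [coeff_affineForm_input, coeff_affineForm_input]
      have h3 := congrArg (MvPolynomial.coeff (Finsupp.single (Sum.inr (k, t)) 1)) h0
      rw [MvPolynomial.coeff_sum] at h3
      simp only [coeff_nfInput, MvPolynomial.coeff_zero, Finset.sum_ite_eq', Finset.mem_univ,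
        if_true, coeff_add] at h3
      rw [coeff_neg]
      linear_combination h3

/-! ### The input-output equation -/

/-- Apart from the minimality of the order, the conditions on an input-output equation hold exactly
for the relations that belong to the monic elements of the annihilator of `C`. -/
lemma isIOCandidate_iff {σ : Equiv.Perm (Fin 1)}
    {p : Fin 1 → DiffPoly (ParamField l) (Fin 1 ⊕ Fin κ)}
    {q : DiffPoly (ParamField l) (Fin 1 ⊕ Fin κ)} :
    S.IsIOCandidate σ p 0 q ↔ ∃ a, a.Monic ∧ S.toStateSpace.obs a = 0 ∧ q = S.ioPoly a := by
  constructor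
  · rintro ⟨hmem, hdeg, -, -, r, hr, hlead⟩
    obtain ⟨a, ha, rfl⟩ := S.eq_ioPoly_of_mem hmem hdeg
    refine ⟨a, ?_, ha, rfl⟩
    rw [ioPoly_eq_affineForm, diffOrd_affineForm] at hr
    rw [ioPoly_eq_affineForm, coeff_affineForm_out] at hlead
    rw [Monic, leadingCoeff, natDegree_eq_of_degree_eq_some hr, hlead]
  · rintro ⟨a, hmonic, ha, rfl⟩
    refine ⟨S.inclYU_ioPoly_mem ha, ?_, ?_, ?_, a.natDegree, ?_, ?_⟩
    · rw [ioPoly_eq_affineForm]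
      exact totalDegree_affineForm_le _ _
    · intro i hi
      rw [Subsingleton.elim i 0] at hi
      exact absurd hi (lt_irrefl _)
    · intro i hi
      rw [Subsingleton.elim i 0] at hi
      exact absurd hi (lt_irrefl _)
    · rw [ioPoly_eq_affineForm, diffOrd_affineForm, degree_eq_natDegree hmonic.ne_zero]
    · rw [ioPoly_eq_affineForm, coeff_affineForm_out]
      exact hmonic

/-- The input-output equation is the relation that belongs to the monic generator of the
annihilator of `C`. -/
lemma isFullIOSet_iff {a : (ParamField l)[X]} (ha : a.Monic)
    (hmin : ∀ f, S.toStateSpace.obs f = 0 ↔ a ∣ f)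
    {p : Fin 1 → DiffPoly (ParamField l) (Fin 1 ⊕ Fin κ)} :
    S.IsFullIOSet p ↔ p = fun _ => S.ioPoly a := by
  have hord : ∀ f, diffOrd (Sum.inl 0) (S.ioPoly f) = f.degree := fun f => by
    rw [ioPoly_eq_affineForm, diffOrd_affineForm]
  constructor
  · rintro ⟨σ, hσ⟩
    obtain ⟨hc, hle⟩ := hσ 0
    obtain ⟨f, hf, hf0, hpf⟩ := S.isIOCandidate_iff.1 hc
    have h1 := hle _ (S.isIOCandidate_iff.2 ⟨a, ha, (hmin a).2 dvd_rfl, rfl⟩)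
    rw [hpf, hord, hord] at h1
    have h2 : f = a := eq_of_monic_of_dvd_of_natDegree_le ha hf ((hmin f).1 hf0)
      (natDegree_le_natDegree h1)
    funext j
    rw [Subsingleton.elim j 0, hpf, h2]
  · rintro rfl
    refine ⟨1, fun j => ?_⟩
    rw [Subsingleton.elim j 0]
    refine ⟨S.isIOCandidate_iff.2 ⟨a, ha, (hmin a).2 dvd_rfl, rfl⟩, fun q hq => ?_⟩
    obtain ⟨f, hf, hf0, rfl⟩ := S.isIOCandidate_iff.1 hq
    rw [hord, hord]
    exact degree_le_of_dvd ((hmin f).1 hf0) hf.ne_zero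

end LinearSystem
end LinearIdent

namespace LinearIdent
open Polynomial Matrix

/-! ### Germs of analytic functions and their derivatives at the origin -/

/-- The sequence of the derivatives at `0` of an analytic function; it determines the germ of the
function at `0`. -/
def jet (φ : AnalyticFn) (j : ℕ) : ℂ := iteratedDeriv j φ.1 0

lemma eventuallyEq_iff_jet_eq (φ ψ : AnalyticFn) : φ.1 =ᶠ[𝓝 0] ψ.1 ↔ jet φ = jet ψ := by
  constructor
  · intro h
    ext j
    exact h.iteratedDeriv_eq j
  · intro h
    have h1 := φ.2.hasFPowerSeriesAt.sub ψ.2.hasFPowerSeriesAt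
    have h2 : ∀ j, iteratedDeriv j φ.1 0 = iteratedDeriv j ψ.1 0 := fun j => congr_fun h j
    simp only [h2, sub_self] at h1
    filter_upwards [h1.eventually_eq_zero] with t ht
    exact sub_eq_zero.1 ht

/-- The inputs together with the constant function `1`. -/
def inputFn {κ : ℕ} (u : Fin κ → AnalyticFn) (o : Option (Fin κ)) : AnalyticFn :=
  o.elim ⟨fun _ => 1, analyticAt_const⟩ u

lemma jet_inputFn {κ : ℕ} (u : Fin κ → AnalyticFn) (o : Option (Fin κ)) :
    jet (inputFn u o) = StateSpace.withUnit (fun k => jet (u k)) o := by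
  rcases o with _ | k
  · ext j
    change iteratedDeriv j (fun _ : ℂ => (1 : ℂ)) 0 = unitSeq ℂ j
    rw [iteratedDeriv_const]
    simp [unitSeq, Pi.single_apply]
  · rfl

lemma iteratedDeriv_sum_mul {ι : Type*} (s : Finset ι) (c : ι → ℂ) (φ : ι → AnalyticFn) (j : ℕ) :
    iteratedDeriv j (fun t => ∑ i ∈ s, c i * (φ i).1 t) 0 = ∑ i ∈ s, c i * jet (φ i) j := by
  rw [iteratedDeriv_fun_sum fun i _ => contDiffAt_const.mul (φ i).2.contDiffAt]
  exact Finset.sum_congr rfl fun i _ => iteratedDeriv_const_mul_field _ _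

lemma iteratedDeriv_sum_add_sum {ι ι' : Type*} (s : Finset ι) (c : ι → ℂ) (φ : ι → AnalyticFn)
    (s' : Finset ι') (c' : ι' → ℂ) (ψ : ι' → AnalyticFn) (j : ℕ) :
    iteratedDeriv j (fun t => ∑ i ∈ s, c i * (φ i).1 t + ∑ i ∈ s', c' i * (ψ i).1 t) 0 =
      ∑ i ∈ s, c i * jet (φ i) j + ∑ i ∈ s', c' i * jet (ψ i) j := by
  rw [← iteratedDeriv_sum_mul, ← iteratedDeriv_sum_mul]
  refine iteratedDeriv_add ?_ ?_
  · exact ContDiffAt.sum fun i _ => contDiffAt_const.mul (φ i).2.contDiffAt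
  · exact ContDiffAt.sum fun i _ => contDiffAt_const.mul (ψ i).2.contDiffAt

namespace LinearSystem

variable {n κ l : ℕ} (S : LinearSystem n 1 κ l)

/-- The coefficient matrices at given parameter values. -/
def specialize (μ : Fin l → ℂ) : StateSpace ℂ (Fin n) (Option (Fin κ)) where
  A i j := ratEval (S.toStateSpace.A i j) μ
  B i o := ratEval (S.toStateSpace.B i o) μ
  C j := ratEval (S.toStateSpace.C j) μ
  D o := ratEval (S.toStateSpace.D o) μ

lemma evalAt_of_totalDegree_le_one {F : MvPolynomial (Fin n ⊕ Fin κ) (ParamField l)}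
    (hF : F.totalDegree ≤ 1) (μ : Fin l → ℂ) (z : Fin n ⊕ Fin κ → ℂ) :
    evalAt F μ z = ratEval (F.coeff 0) μ +
      ∑ v, ratEval (F.coeff (Finsupp.single v 1)) μ * z v := by
  rw [evalAt, sum_support_of_totalDegree_le_one hF _ fun e he => by rw [he, ratEval_zero, zero_mul]]
  simp

lemma evalAt_f (i : Fin n) (μ : Fin l → ℂ) (x : Fin n → ℂ) (u : Fin κ → AnalyticFn) (t : ℂ) :
    evalAt (S.f i) μ (Sum.elim x fun k => (u k).1 t) =
      ∑ j, (S.specialize μ).A i j * x j + ∑ o, (S.specialize μ).B i o * (inputFn u o).1 t := by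
  rw [evalAt_of_totalDegree_le_one (S.degree_f i), Fintype.sum_sum_type, Fintype.sum_option]
  simp only [specialize, toStateSpace, inputFn, Option.elim, Sum.elim_inl, Sum.elim_inr]
  ring

lemma evalAt_g (μ : Fin l → ℂ) (x : Fin n → ℂ) (u : Fin κ → AnalyticFn) (t : ℂ) :
    evalAt (S.g 0) μ (Sum.elim x fun k => (u k).1 t) =
      ∑ j, (S.specialize μ).C j * x j + ∑ o, (S.specialize μ).D o * (inputFn u o).1 t := by
  rw [evalAt_of_totalDegree_le_one (S.degree_g 0), Fintype.sum_sum_type, Fintype.sum_option]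
  simp only [specialize, toStateSpace, inputFn, Option.elim, Sum.elim_inl, Sum.elim_inr]
  ring

/-- The derivatives of the output at `0` are those computed from the coefficient matrices. -/
lemma IsOutput.jet_eq {S : LinearSystem n 1 κ l} {x₀ : Fin n → ℂ} {μ : Fin l → ℂ}
    {u : Fin κ → AnalyticFn} {Y : Fin 1 → AnalyticFn} (h : S.IsOutput x₀ μ u Y) :
    jet (Y 0) = (S.specialize μ).outSeq (StateSpace.withUnit fun k => jet (u k)) x₀ := by
  obtain ⟨X, ⟨hX0, hX⟩, hY⟩ := h
  have htraj : (S.specialize μ).IsTraj (fun v => jet (X v))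
      (StateSpace.withUnit fun k => jet (u k)) (jet (Y 0)) := by
    constructor
    · intro v j
      have h1 : deriv (X v).1 =ᶠ[𝓝 0] fun t => ∑ j, (S.specialize μ).A v j * (X j).1 t +
          ∑ o, (S.specialize μ).B v o * (inputFn u o).1 t := by
        filter_upwards [hX v] with t ht
        rw [ht.deriv, evalAt_f]
      rw [jet, iteratedDeriv_succ', h1.iteratedDeriv_eq, iteratedDeriv_sum_add_sum]
      simp only [jet_inputFn, smul_eq_mul]
    · intro j
      have h1 : (Y 0).1 =ᶠ[𝓝 0] fun t => ∑ j, (S.specialize μ).C j * (X j).1 t +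
          ∑ o, (S.specialize μ).D o * (inputFn u o).1 t := by
        filter_upwards [hY 0] with t ht
        rw [ht, evalAt_g]
      rw [jet, h1.iteratedDeriv_eq, iteratedDeriv_sum_add_sum]
      simp only [jet_inputFn, smul_eq_mul]
  rw [htraj.eq_outSeq]
  congr 1
  ext v
  simp [jet, hX0]

/-- A linear differential equation with constant coefficients and an analytic inhomogeneity has
an analytic solution, by variation of constants. -/
lemma exists_analytic_solution {E : Type*} [NormedAddCommGroup E] [NormedSpace ℂ E]
    [CompleteSpace E] (L : E →L[ℂ] E) {b : ℂ → E} (hb : AnalyticAt ℂ b 0) (x₀ : E) :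
    ∃ X : ℂ → E, AnalyticAt ℂ X 0 ∧ X 0 = x₀ ∧ ∀ᶠ t in 𝓝 0, HasDerivAt X (L (X t) + b t) t := by
  obtain ⟨r, hr, hball⟩ := Metric.eventually_nhds_iff_ball.1 hb.eventually_analyticAt
  have hexp : ∀ t : ℂ, HasDerivAt (fun s : ℂ => NormedSpace.exp (s • L))
      (L * NormedSpace.exp (t • L)) t := fun t => hasDerivAt_exp_smul_const' L t
  have hexpn : ∀ t : ℂ, HasDerivAt (fun s : ℂ => NormedSpace.exp (s • (-L)))
      (-L * NormedSpace.exp (t • (-L))) t := fun t => hasDerivAt_exp_smul_const' (-L) t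
  have hF : DifferentiableOn ℂ (fun t => NormedSpace.exp (t • (-L)) (b t)) (Metric.ball 0 r) :=
    fun t ht => ((hexpn t).differentiableAt.clm_apply
      (hball t ht).differentiableAt).differentiableWithinAt
  obtain ⟨G, hG0, hG⟩ := hF.isExactOn_ball.with_val_at 0 x₀
  have hX : ∀ t ∈ Metric.ball (0 : ℂ) r, HasDerivAt (fun t => NormedSpace.exp (t • L) (G t))
      (L (NormedSpace.exp (t • L) (G t)) + b t) t := by
    intro t ht
    have h1 := (hexp t).clm_apply (hG t ht)
    have h2 : NormedSpace.exp (t • L) (NormedSpace.exp (t • (-L)) (b t)) = b t := by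
      have h3 : NormedSpace.exp (t • L) * NormedSpace.exp (t • (-L)) = 1 := by
        let : NormedAlgebra ℚ (E →L[ℂ] E) := NormedAlgebra.restrictScalars ℚ ℂ _
        rw [smul_neg, ← NormedSpace.exp_add_of_commute (Commute.neg_right (Commute.refl _)),
          add_neg_cancel, NormedSpace.exp_zero]
      exact congr($h3 (b t))
    rw [h2] at h1
    exact h1
  refine ⟨fun t => NormedSpace.exp (t • L) (G t), ?_, ?_, ?_⟩
  · have hd : DifferentiableOn ℂ (fun t => NormedSpace.exp (t • L) (G t)) (Metric.ball 0 r) :=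
      fun t ht => (hX t ht).differentiableAt.differentiableWithinAt
    exact hd.analyticAt (Metric.ball_mem_nhds 0 hr)
  · simp [NormedSpace.exp_zero, hG0]
  · filter_upwards [Metric.ball_mem_nhds 0 hr] with t ht
    exact hX t ht

lemma exists_isOutput (x₀ : Fin n → ℂ) (μ : Fin l → ℂ) (u : Fin κ → AnalyticFn) :
    ∃ Y, S.IsOutput x₀ μ u Y := by
  set 𝒮 := S.specialize μ
  have han : ∀ c : Option (Fin κ) → ℂ, AnalyticAt ℂ (fun t => ∑ o, c o * (inputFn u o).1 t) 0 :=
    fun c => Finset.analyticAt_fun_sum _ fun o _ => analyticAt_const.mul (inputFn u o).2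
  obtain ⟨X, hX, hX0, hX'⟩ := exists_analytic_solution
    (LinearMap.toContinuousLinearMap 𝒮.A.mulVecLin)
    (b := fun t i => ∑ o, 𝒮.B i o * (inputFn u o).1 t) (AnalyticAt.pi fun i => han _) x₀
  have hXi : ∀ i, AnalyticAt ℂ (fun t => X t i) 0 := fun i => (analyticAt_pi_iff.1 hX) i
  refine ⟨fun _ => ⟨fun t => ∑ j, 𝒮.C j * X t j + ∑ o, 𝒮.D o * (inputFn u o).1 t, ?_⟩,
    fun i => ⟨fun t => X t i, hXi i⟩, ⟨fun i => congr_fun hX0 i, fun i => ?_⟩, fun j => ?_⟩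
  · exact (Finset.analyticAt_fun_sum _ fun j _ => analyticAt_const.mul (hXi j)).add (han _)
  · filter_upwards [hX'] with t ht
    rw [evalAt_f]
    exact hasDerivAt_pi.1 ht i
  · refine Filter.Eventually.of_forall fun t => ?_
    rw [Subsingleton.elim j 0, evalAt_g]

/-- Equality of two outputs as germs is equality of the derivatives at `0`. -/
lemma exists_common_output_iff {x₀ x₁ : Fin n → ℂ} {μ ν : Fin l → ℂ} {u : Fin κ → AnalyticFn} :
    (∃ Y, S.IsOutput x₀ μ u Y ∧ S.IsOutput x₁ ν u Y) ↔
      (S.specialize μ).outSeq (StateSpace.withUnit fun k => jet (u k)) x₀ =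
        (S.specialize ν).outSeq (StateSpace.withUnit fun k => jet (u k)) x₁ := by
  constructor
  · rintro ⟨Y, h0, h1⟩
    rw [← h0.jet_eq, ← h1.jet_eq]
  · intro h
    obtain ⟨Y, hY⟩ := S.exists_isOutput x₀ μ u
    obtain ⟨Z, hZ⟩ := S.exists_isOutput x₁ ν u
    refine ⟨Y, hY, ?_⟩
    rw [← hY.jet_eq, ← hZ.jet_eq, ← eventuallyEq_iff_jet_eq] at h
    obtain ⟨X, hX, hZX⟩ := hZ
    refine ⟨X, hX, fun j => ?_⟩
    rw [Subsingleton.elim j 0]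
    filter_upwards [h, hZX 0] with t h1 h2
    rw [h1, h2]

end LinearSystem

/-! ### Generic inputs -/

/-- The inputs that satisfy no linear differential equation of order at most `N` contain a
nonempty Zariski open set. -/
lemma exists_isNonemptyZariskiOpenFn (κ N : ℕ) :
    ∃ U : Set (Fin κ → AnalyticFn), IsNonemptyZariskiOpenFn U ∧
      ∀ u ∈ U, StateSpace.InputGeneric N fun k => jet (u k) := by
  -- the derivatives of order at least one of a relation do not contain its constant term; the
  -- column `b` of the matrix of derivatives belongs to the derivative of order `pos b + 1`. For the
  -- functions `z ^ (ord k)` this matrix is diagonal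
  let pos : Fin κ × Fin (N + 1) → ℕ := fun a => a.1 * (2 * N + 2) + (N - a.2)
  let ord : Fin κ → ℕ := fun k => k * (2 * N + 2) + N + 1
  let P : Matrix (Fin κ × Fin (N + 1)) (Fin κ × Fin (N + 1)) (MvPolynomial (Fin κ × ℕ) ℂ) :=
    Matrix.of fun a b => MvPolynomial.X (a.1, a.2 + (pos b + 1))
  have heval : ∀ u : Fin κ → AnalyticFn,
      MvPolynomial.eval (fun a : Fin κ × ℕ => iteratedDeriv a.2 (u a.1).1 0) P.det =
        (Matrix.of fun a b : Fin κ × Fin (N + 1) => jet (u a.1) (a.2 + (pos b + 1))).det := by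
    intro u
    rw [RingHom.map_det]
    congr 1
    ext a b
    simp [P, jet]
  refine ⟨_, ⟨?_, P.det, rfl⟩, ?_⟩
  · let u : Fin κ → AnalyticFn := fun k => ⟨fun z => z ^ ord k, analyticAt_id.pow _⟩
    refine ⟨u, ?_⟩
    change MvPolynomial.eval _ P.det ≠ 0
    rw [heval u]
    have hdiag : (Matrix.of fun a b : Fin κ × Fin (N + 1) =>
        jet (u a.1) (a.2 + (pos b + 1))) =
          Matrix.diagonal fun a => ((ord a.1).factorial : ℂ) := by
      ext a b
      rw [Matrix.of_apply, jet, iteratedDeriv_fun_pow_zero, Matrix.diagonal_apply, Nat.cast_ite,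
        Nat.cast_zero]
      obtain ⟨⟨k, hk⟩, ⟨t, ht⟩⟩ := a
      obtain ⟨⟨k', hk'⟩, ⟨t', ht'⟩⟩ := b
      simp only [pos, ord, Prod.mk.injEq, Fin.mk.injEq]
      refine if_congr ?_ rfl rfl
      constructor
      · intro h
        have hkk : k = k' := by
          rcases lt_trichotomy k k' with hlt | heq | hlt
          · have := Nat.mul_le_mul_right (2 * N + 2) (Nat.succ_le_of_lt hlt)
            rw [Nat.succ_mul] at this
            omega
          · exact heq
          · have := Nat.mul_le_mul_right (2 * N + 2) (Nat.succ_le_of_lt hlt)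
            rw [Nat.succ_mul] at this
            omega
        subst hkk
        exact ⟨rfl, by omega⟩
      · rintro ⟨rfl, rfl⟩
        omega
    rw [hdiag, Matrix.det_diagonal]
    exact Finset.prod_ne_zero_iff.2 fun a _ => by exact_mod_cast (ord a.1).factorial_ne_zero
  · intro u hu f c hf h0 k
    change MvPolynomial.eval _ P.det ≠ 0 at hu
    rw [heval] at hu
    set M := Matrix.of fun a b : Fin κ × Fin (N + 1) => jet (u a.1) (a.2 + (pos b + 1))
    have hv : (fun a : Fin κ × Fin (N + 1) => (f a.1).coeff a.2) ᵥ* M = 0 := by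
      ext b
      have h1 := congr_fun h0 (pos b + 1)
      simp only [Pi.add_apply, Finset.sum_apply, Pi.smul_apply, unitSeq,
        Pi.single_eq_of_ne (Nat.succ_ne_zero (pos b)), smul_zero, add_zero, Pi.zero_apply] at h1
      rw [Pi.zero_apply, ← h1, vecMul, dotProduct, Fintype.sum_prod_type]
      refine Finset.sum_congr rfl fun k _ => ?_
      rw [op_apply, sum_over_range' _ (by simp) (N + 1) (Nat.lt_succ_of_le (hf k)),
        Finset.sum_range]
      rfl
    have hv0 : (fun a : Fin κ × Fin (N + 1) => (f a.1).coeff a.2) = 0 := by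
      by_contra hne
      exact hu (Matrix.exists_vecMul_eq_zero_iff.1 ⟨_, hne, hv⟩)
    ext t
    rcases lt_or_ge t (N + 1) with ht | ht
    · exact congr_fun hv0 (k, ⟨t, ht⟩)
    · rw [coeff_zero, coeff_eq_zero_of_natDegree_lt (by have := hf k; omega)]

end LinearIdent

namespace LinearIdent
open Polynomial Matrix

/-! ### Clearing denominators -/

lemma eval_sumAlgEquiv_symm {n l : ℕ} (p : MvPolynomial (Fin n) (MvPolynomial (Fin l) ℂ))
    (x : Fin n → ℂ) (μ : Fin l → ℂ) :
    MvPolynomial.eval (Sum.elim x μ) ((MvPolynomial.sumAlgEquiv ℂ (Fin n) (Fin l)).symm p) =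
      MvPolynomial.eval₂ (MvPolynomial.eval μ) x p := by
  obtain ⟨q, rfl⟩ := (MvPolynomial.sumAlgEquiv ℂ (Fin n) (Fin l)).surjective p
  rw [AlgEquiv.symm_apply_apply]
  induction q using MvPolynomial.induction_on with
  | C c => simp
  | add p q hp hq => simp only [map_add, hp, hq, MvPolynomial.eval₂_add]
  | mul_X p i hp =>
    rw [map_mul, map_mul, hp, MvPolynomial.eval₂_mul]
    rcases i with i | i <;> simp

/-- A nonzero polynomial over `ℂ(μ)` does not vanish at generic points, whatever the way in which
it is specialized: multiplied by the value of a common denominator of the coefficients, the value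
becomes that of the numerator. -/
lemma exists_eval_specialization_ne_zero {n l : ℕ} {P : MvPolynomial (Fin n) (ParamField l)}
    (hP : P ≠ 0) :
    ∃ Q : MvPolynomial (Fin n ⊕ Fin l) ℂ, Q ≠ 0 ∧ ∀ x μ,
      MvPolynomial.eval (Sum.elim x μ) Q ≠ 0 → ∀ p : MvPolynomial (Fin n) (localRing μ),
        MvPolynomial.map (algebraMap (localRing μ) (ParamField l)) p = P →
          MvPolynomial.eval₂ (evalHom μ) x p ≠ 0 := by
  let : Algebra (MvPolynomial (Fin n) (MvPolynomial (Fin l) ℂ))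
    (MvPolynomial (Fin n) (ParamField l)) := MvPolynomial.algebraMvPolynomial
  obtain ⟨⟨P₁, g⟩, hg⟩ := IsLocalization.surj
    ((nonZeroDivisors (MvPolynomial (Fin l) ℂ)).map
      (MvPolynomial.C : _ →+* MvPolynomial (Fin n) (MvPolynomial (Fin l) ℂ))) P
  have hmap : ∀ q : MvPolynomial (Fin n) (MvPolynomial (Fin l) ℂ),
      algebraMap _ (MvPolynomial (Fin n) (ParamField l)) q =
        MvPolynomial.map (algebraMap _ (ParamField l)) q := fun _ => rfl
  obtain ⟨g, g₀, hg₀, rfl⟩ := g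
  rw [hmap, hmap] at hg
  change P * MvPolynomial.map _ (MvPolynomial.C g₀) = MvPolynomial.map _ P₁ at hg
  have hg₀' : g₀ ≠ 0 := nonZeroDivisors.ne_zero hg₀
  refine ⟨(MvPolynomial.sumAlgEquiv ℂ (Fin n) (Fin l)).symm P₁, ?_, fun x μ hQ p hp h0 => hQ ?_⟩
  · intro h0
    rw [EmbeddingLike.map_eq_zero_iff] at h0
    rw [h0, map_zero, MvPolynomial.map_C, mul_eq_zero, MvPolynomial.C_eq_zero,
      map_eq_zero_iff _ algebraMap_injective] at hg
    exact hg.elim hP hg₀'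
  · rw [eval_sumAlgEquiv_symm]
    have h1 : p * MvPolynomial.C (algebraMap _ (localRing μ) g₀) =
        MvPolynomial.map (algebraMap _ (localRing μ)) P₁ := by
      apply MvPolynomial.map_injective (algebraMap (localRing μ) (ParamField l))
        Subtype.val_injective
      rw [map_mul, hp, MvPolynomial.map_C, MvPolynomial.map_map,
        ← IsScalarTower.algebraMap_eq, ← IsScalarTower.algebraMap_apply, ← hg, MvPolynomial.map_C]
    have h2 := congrArg (MvPolynomial.eval₂ (evalHom μ) x) h1
    rw [MvPolynomial.eval₂_mul, h0, zero_mul, MvPolynomial.eval₂_map] at h2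
    have h3 : (evalHom μ).comp (algebraMap _ (localRing μ)) = MvPolynomial.eval μ := by
      refine RingHom.ext fun q => ?_
      exact (definedAt_algebraMap q μ).2
    rw [h3] at h2
    exact h2.symm

lemma eval_aeval_sum_elim {n l : ℕ} (x : Fin n → ℂ) (P : MvPolynomial (Fin n ⊕ Fin l) ℂ)
    (μ : Fin l → ℂ) :
    MvPolynomial.eval μ (MvPolynomial.aeval
      (Sum.elim (fun i => MvPolynomial.C (x i)) MvPolynomial.X) P) =
      MvPolynomial.eval (Sum.elim x μ) P := by
  induction P using MvPolynomial.induction_on with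
  | C c => simp
  | add p q hp hq => rw [map_add, map_add, hp, hq, map_add]
  | mul_X p i hp =>
    rw [map_mul, map_mul, hp, map_mul]
    rcases i with i | i <;> simp

lemma exists_eval_ne_zero {σ : Type*} {Q : MvPolynomial σ ℂ} (hQ : Q ≠ 0) :
    ∃ z, MvPolynomial.eval z Q ≠ 0 := by
  by_contra! h
  exact hQ (MvPolynomial.funext fun z => by rw [h z, map_zero])

lemma eval_prod_denom_ne_zero {l : ℕ} {ι : Type*} {s : Finset ι} {c : ι → ParamField l}
    {μ : Fin l → ℂ} (h : MvPolynomial.eval μ (∏ i ∈ s, denom (c i)) ≠ 0) :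
    ∀ i ∈ s, DefinedAt (c i) μ := by
  rw [MvPolynomial.eval_prod] at h
  exact Finset.prod_ne_zero_iff.1 h

lemma definedAt_zero {l : ℕ} (μ : Fin l → ℂ) : DefinedAt (0 : ParamField l) μ :=
  (localRing μ).zero_mem

lemma definedAt_neg {l : ℕ} {c : ParamField l} {μ : Fin l → ℂ} (h : DefinedAt c μ) :
    DefinedAt (-c) μ ∧ ratEval (-c) μ = -ratEval c μ :=
  by
  have h1 := definedAt_mul (definedAt_algebraMap (-1) μ).1 h
  rw [(definedAt_algebraMap (-1) μ).2, map_neg, map_neg, map_one, map_one, neg_one_mul,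
    neg_one_mul] at h1
  exact h1

namespace LinearSystem

variable {n κ l : ℕ} (S : LinearSystem n 1 κ l)

/-! ### Specialization of the parameters -/

/-- The coefficient matrices lift to the local ring of any point of `Ω`. -/
lemma exists_localRing_lift {μ : Fin l → ℂ} (hμ : μ ∈ S.Ω) :
    ∃ 𝒮 : StateSpace (localRing μ) (Fin n) (Option (Fin κ)),
      𝒮.map (algebraMap (localRing μ) (ParamField l)) = S.toStateSpace ∧
        𝒮.map (evalHom μ) = S.specialize μ :=
  ⟨{ A := fun i j => ⟨S.toStateSpace.A i j, hμ.1 _ _⟩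
     B := fun i o => ⟨S.toStateSpace.B i o, by cases o <;> exact hμ.1 _ _⟩
     C := fun j => ⟨S.toStateSpace.C j, hμ.2 _ _⟩
     D := fun o => ⟨S.toStateSpace.D o, by cases o <;> exact hμ.2 _ _⟩ }, rfl, rfl⟩

variable {a : (ParamField l)[X]}

/-- The input-output equation can be specialized at every point of `Ω`: its coefficients are
well-defined there, because the annihilator of `C` divides the characteristic polynomial of `A`. -/
lemma exists_specialized_annihilator (ha : a.Monic)
    (hmin : ∀ f, S.toStateSpace.obs f = 0 ↔ a ∣ f) {μ : Fin l → ℂ} (hμ : μ ∈ S.Ω) :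
    ∃ b : ℂ[X], b.Monic ∧ b.natDegree = a.natDegree ∧ (S.specialize μ).obs b = 0 ∧
      (∀ i, DefinedAt (a.coeff i) μ ∧ ratEval (a.coeff i) μ = b.coeff i) ∧
      ∀ o t, DefinedAt ((S.toStateSpace.resp o a).coeff t) μ ∧
        ratEval ((S.toStateSpace.resp o a).coeff t) μ = ((S.specialize μ).resp o b).coeff t := by
  obtain ⟨𝒮, h𝒮, h𝒮μ⟩ := S.exists_localRing_lift hμ
  have hinj : Function.Injective (algebraMap (localRing μ) (ParamField l)) :=
    Subtype.val_injective
  have hdvd : a ∣ 𝒮.A.charpoly.map (algebraMap (localRing μ) (ParamField l)) := by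
    have h1 : (𝒮.A.map (algebraMap (localRing μ) (ParamField l))) = S.toStateSpace.A :=
      congrArg StateSpace.A h𝒮
    rw [← Matrix.charpoly_map, h1, ← hmin]
    exact S.toStateSpace.obs_charpoly
  obtain ⟨a', ha'⟩ := exists_monic_lift_of_dvd 𝒮.A.charpoly_monic ha hdvd
  have hmonic : a'.Monic := hinj.monic_map_iff.2 (by rw [ha']; exact ha)
  have hcoeff : ∀ i, algebraMap (localRing μ) (ParamField l) (a'.coeff i) = a.coeff i := fun i => by
    rw [← ha', coeff_map]
  refine ⟨a'.map (evalHom μ), hmonic.map _, ?_, ?_, fun i => ?_, fun o t => ?_⟩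
  · rw [hmonic.natDegree_map, ← ha', hmonic.natDegree_map]
  · rw [← h𝒮μ, StateSpace.obs_map]
    have h1 : 𝒮.obs a' = 0 := by
      have h2 := 𝒮.obs_map (algebraMap (localRing μ) (ParamField l)) a'
      rw [h𝒮, ha', (hmin a).2 dvd_rfl] at h2
      ext v
      exact (congr_fun h2 v).symm
    rw [h1]
    ext v
    exact map_zero (evalHom μ)
  · rw [← hcoeff, coeff_map]
    exact ⟨(a'.coeff i).2, rfl⟩
  · have h1 := 𝒮.resp_map (algebraMap (localRing μ) (ParamField l)) o a'
    rw [h𝒮, ha'] at h1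
    have h2 := 𝒮.resp_map (evalHom μ) o a'
    rw [h𝒮μ] at h2
    rw [h1, h2, coeff_map, coeff_map]
    exact ⟨((𝒮.resp o a').coeff t).2, rfl⟩

lemma coeff_ioPoly (e : (Fin 1 ⊕ Fin κ) × ℕ →₀ ℕ) :
    (S.ioPoly a).coeff e = 0 ∨ (∃ i, (S.ioPoly a).coeff e = a.coeff i) ∨
      (∃ k t, (S.ioPoly a).coeff e = -(S.toStateSpace.resp (some k) a).coeff t) ∨
      (S.ioPoly a).coeff e = -(S.toStateSpace.resp none a).coeff 0 := by
  rw [ioPoly_eq_affineForm]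
  by_cases h0 : (affineForm a fun o => -S.toStateSpace.resp o a).coeff e = 0
  · exact Or.inl h0
  right
  rcases eq_zero_or_single_of_mem_support (totalDegree_affineForm_le _ _)
    (MvPolynomial.mem_support_iff.2 h0) with rfl | ⟨⟨j | k, t⟩, rfl⟩
  · rw [coeff_affineForm_zero, coeff_neg]
    exact Or.inr (Or.inr rfl)
  · rw [Subsingleton.elim j 0, coeff_affineForm_out]
    exact Or.inl ⟨t, rfl⟩
  · rw [coeff_affineForm_input, coeff_neg]
    exact Or.inr (Or.inl ⟨k, t, rfl⟩)

/-- The coefficients of the input-output equation take the same values at two points if and only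
if the specialized equations coincide. -/
lemma coeff_ioPoly_agree_iff {μ ν : Fin l → ℂ} {b c : ℂ[X]}
    (hb : ∀ i, DefinedAt (a.coeff i) μ ∧ ratEval (a.coeff i) μ = b.coeff i)
    (hb' : ∀ o t, DefinedAt ((S.toStateSpace.resp o a).coeff t) μ ∧
        ratEval ((S.toStateSpace.resp o a).coeff t) μ = ((S.specialize μ).resp o b).coeff t)
    (hc : ∀ i, DefinedAt (a.coeff i) ν ∧ ratEval (a.coeff i) ν = c.coeff i)
    (hc' : ∀ o t, DefinedAt ((S.toStateSpace.resp o a).coeff t) ν ∧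
        ratEval ((S.toStateSpace.resp o a).coeff t) ν = ((S.specialize ν).resp o c).coeff t) :
    (∀ e, DefinedAt ((S.ioPoly a).coeff e) μ ∧ DefinedAt ((S.ioPoly a).coeff e) ν) ∧
    ((∀ e, ratEval ((S.ioPoly a).coeff e) μ = ratEval ((S.ioPoly a).coeff e) ν) ↔
      b = c ∧ (∀ k, (S.specialize μ).resp (some k) b = (S.specialize ν).resp (some k) c) ∧
        ((S.specialize μ).resp none b).coeff 0 = ((S.specialize ν).resp none c).coeff 0) := by
  refine ⟨fun e => ?_, fun h => ⟨?_, fun k => ?_, ?_⟩, fun ⟨h1, h2, h3⟩ e => ?_⟩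
  · rcases S.coeff_ioPoly (a := a) e with h | ⟨i, h⟩ | ⟨k, t, h⟩ | h <;> rw [h]
    · exact ⟨definedAt_zero _, definedAt_zero _⟩
    · exact ⟨(hb i).1, (hc i).1⟩
    · exact ⟨(definedAt_neg (hb' _ t).1).1, (definedAt_neg (hc' _ t).1).1⟩
    · exact ⟨(definedAt_neg (hb' _ 0).1).1, (definedAt_neg (hc' _ 0).1).1⟩
  · ext i
    have h1 := h (Finsupp.single (Sum.inl 0, i) 1)
    rwa [ioPoly_eq_affineForm, coeff_affineForm_out, (hb i).2, (hc i).2] at h1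
  · ext t
    have h1 := h (Finsupp.single (Sum.inr k, t) 1)
    rwa [ioPoly_eq_affineForm, coeff_affineForm_input, coeff_neg, (definedAt_neg (hb' _ t).1).2,
      (definedAt_neg (hc' _ t).1).2, neg_inj, (hb' _ t).2, (hc' _ t).2] at h1
  · have h1 := h 0
    rwa [ioPoly_eq_affineForm, coeff_affineForm_zero, coeff_neg, (definedAt_neg (hb' _ 0).1).2,
      (definedAt_neg (hc' _ 0).1).2, neg_inj, (hb' _ 0).2, (hc' _ 0).2] at h1
  · rcases S.coeff_ioPoly (a := a) e with h | ⟨i, h⟩ | ⟨k, t, h⟩ | h <;> rw [h]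
    · simp
    · rw [(hb i).2, (hc i).2, h1]
    · rw [(definedAt_neg (hb' _ t).1).2, (definedAt_neg (hc' _ t).1).2, (hb' _ t).2, (hc' _ t).2, h2]
    · rw [(definedAt_neg (hb' _ 0).1).2, (definedAt_neg (hc' _ 0).1).2, (hb' _ 0).2, (hc' _ 0).2, h3]

/-- At generic points of `Ω`, the Hankel matrix of the specialized system is nonsingular. -/
lemma exists_specialized_hankel_ne_zero {m s : ℕ} {x : Fin n → ParamField l}
    (hx : (S.toStateSpace.hankel x m s).det ≠ 0) :
    ∃ Q : MvPolynomial (Fin n ⊕ Fin l) ℂ, Q ≠ 0 ∧ ∀ x₀, ∀ μ ∈ S.Ω,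
      MvPolynomial.eval (Sum.elim x₀ μ) Q ≠ 0 → ((S.specialize μ).hankel x₀ m s).det ≠ 0 := by
  -- the determinant for a generic initial state, over any ring of coefficients
  let P : ∀ {R : Type} [CommRing R], StateSpace R (Fin n) (Option (Fin κ)) →
      MvPolynomial (Fin n) R := fun 𝒮 =>
    ((𝒮.map MvPolynomial.C).hankel MvPolynomial.X m s).det
  have hP : ∀ {R R' : Type} [CommRing R] [CommRing R']
      (𝒮 : StateSpace R (Fin n) (Option (Fin κ))) (φ : R →+* R') (z : Fin n → R'),
      MvPolynomial.eval₂ φ z (P 𝒮) = ((𝒮.map φ).hankel z m s).det := by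
    intro R R' _ _ 𝒮 φ z
    have h1 := (𝒮.map MvPolynomial.C).hankel_map MvPolynomial.X m s (MvPolynomial.eval₂Hom φ z)
    have h2 : (𝒮.map MvPolynomial.C).map (MvPolynomial.eval₂Hom φ z) = 𝒮.map φ := by
      simp [StateSpace.map, Matrix.map_map, Function.comp_def]
    have h3 : (MvPolynomial.eval₂Hom φ z) ∘ MvPolynomial.X = z := by
      ext i
      simp
    rw [h2, h3] at h1
    rw [h1]
    exact RingHom.map_det (MvPolynomial.eval₂Hom φ z) _
  have hPmap : ∀ {R R' : Type} [CommRing R] [CommRing R']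
      (𝒮 : StateSpace R (Fin n) (Option (Fin κ))) (φ : R →+* R'),
      MvPolynomial.map φ (P 𝒮) = P (𝒮.map φ) := by
    intro R R' _ _ 𝒮 φ
    have h1 := hP 𝒮 ((MvPolynomial.C : R' →+* MvPolynomial (Fin n) R').comp φ) MvPolynomial.X
    rwa [← MvPolynomial.eval₂_map, MvPolynomial.eval₂_eta] at h1
  have hP0 : P S.toStateSpace ≠ 0 := by
    intro h0
    have h1 := hP S.toStateSpace (RingHom.id _) x
    rw [h0, MvPolynomial.eval₂_zero] at h1
    exact hx h1.symm
  obtain ⟨Q, hQ, hQ'⟩ := exists_eval_specialization_ne_zero hP0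
  refine ⟨Q, hQ, fun x₀ μ hμ hne => ?_⟩
  obtain ⟨𝒮, h𝒮, h𝒮μ⟩ := S.exists_localRing_lift hμ
  have h1 := hQ' x₀ μ hne (P 𝒮) (by rw [hPmap, h𝒮])
  rwa [hP, h𝒮μ] at h1

/-- The points outside some hypersurface lie in `Ω`. -/
lemma exists_mem_Ω : ∃ G : MvPolynomial (Fin l) ℂ, G ≠ 0 ∧
    ∀ μ, MvPolynomial.eval μ G ≠ 0 → μ ∈ S.Ω := by
  refine ⟨(∏ i, ∏ e ∈ (S.f i).support, denom ((S.f i).coeff e)) *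
    ∏ j, ∏ e ∈ (S.g j).support, denom ((S.g j).coeff e), ?_, fun μ hμ => ?_⟩
  · exact mul_ne_zero
      (Finset.prod_ne_zero_iff.2 fun i _ => Finset.prod_ne_zero_iff.2 fun e _ => denom_ne_zero _)
      (Finset.prod_ne_zero_iff.2 fun i _ => Finset.prod_ne_zero_iff.2 fun e _ => denom_ne_zero _)
  · rw [map_mul, mul_ne_zero_iff, MvPolynomial.eval_prod, MvPolynomial.eval_prod,
      Finset.prod_ne_zero_iff, Finset.prod_ne_zero_iff] at hμ
    have key : ∀ F : MvPolynomial (Fin n ⊕ Fin κ) (ParamField l),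
        MvPolynomial.eval μ (∏ e ∈ F.support, denom (F.coeff e)) ≠ 0 →
          ∀ e, DefinedAt (F.coeff e) μ := by
      intro F hF e
      by_cases he : e ∈ F.support
      · exact eval_prod_denom_ne_zero hF e he
      · rw [MvPolynomial.notMem_support_iff.1 he]
        exact definedAt_zero μ
    exact ⟨fun i => key _ (hμ.1 i (Finset.mem_univ i)), fun j => key _ (hμ.2 j (Finset.mem_univ j))⟩

/-- At generic points of `Ω`, the first derivatives of the output take arbitrary values. -/
lemma exists_observable (ha : a.Monic) (hmin : ∀ f, S.toStateSpace.obs f = 0 ↔ a ∣ f) :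
    ∃ G : MvPolynomial (Fin l) ℂ, G ≠ 0 ∧ ∀ μ ∈ S.Ω, MvPolynomial.eval μ G ≠ 0 →
      ∀ t : ℕ → ℂ, ∃ x, ∀ i < a.natDegree, (S.specialize μ).obs (X ^ i) ⬝ᵥ x = t i := by
  -- a right inverse of the observability matrix over `ℂ(μ)`
  have hind : ∀ c : (ParamField l)[X], c.degree < (a.natDegree : WithBot ℕ) →
      S.toStateSpace.obs (X ^ 0 * c) = 0 → c = 0 := by
    intro c hc h0
    rw [pow_zero, one_mul, hmin] at h0
    exact eq_zero_of_dvd_of_degree_lt h0 (hc.trans_eq (degree_eq_natDegree ha.ne_zero).symm)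
  choose N hN using fun j : ℕ => StateSpace.exists_obs_dotProduct_eq hind (Pi.single j 1)
  refine ⟨∏ j ∈ Finset.range a.natDegree, ∏ v, denom (N j v),
    Finset.prod_ne_zero_iff.2 fun i _ => Finset.prod_ne_zero_iff.2 fun e _ => denom_ne_zero _,
    fun μ hμ hG t => ?_⟩
  rw [MvPolynomial.eval_prod, Finset.prod_ne_zero_iff] at hG
  have hdef : ∀ j < a.natDegree, ∀ v, DefinedAt (N j v) μ := fun j hj v =>
    eval_prod_denom_ne_zero (hG j (Finset.mem_range.2 hj)) v (Finset.mem_univ v)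
  obtain ⟨𝒮, h𝒮, h𝒮μ⟩ := S.exists_localRing_lift hμ
  refine ⟨∑ j ∈ Finset.range a.natDegree, t j • fun v => ratEval (N j v) μ, fun i hi => ?_⟩
  have key : ∀ j < a.natDegree, (S.specialize μ).obs (X ^ i) ⬝ᵥ (fun v => ratEval (N j v) μ) =
      (Pi.single j 1 : ℕ → ℂ) i := by
    intro j hj
    have h1 := hN j i hi
    have h2 := 𝒮.obs_map (algebraMap (localRing μ) (ParamField l)) (X ^ i)
    have h3 := 𝒮.obs_map (evalHom μ) (X ^ i)
    rw [h𝒮, Polynomial.map_pow, Polynomial.map_X] at h2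
    rw [h𝒮μ, Polynomial.map_pow, Polynomial.map_X] at h3
    rw [zero_add, h2] at h1
    rw [h3]
    let Nj : Fin n → localRing μ := fun v => ⟨N j v, hdef j hj v⟩
    have h4 : 𝒮.obs (X ^ i) ⬝ᵥ Nj = (Pi.single j 1 : ℕ → localRing μ) i := by
      apply Subtype.val_injective
      change algebraMap (localRing μ) (ParamField l) _ = algebraMap (localRing μ) (ParamField l) _
      rw [dotProduct, map_sum]
      simp only [map_mul]
      refine Eq.trans h1 ?_
      rw [Pi.single_apply, Pi.single_apply]
      split_ifs <;> simp
    have h5 := congrArg (evalHom μ) h4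
    rw [dotProduct, map_sum] at h5
    simp only [map_mul] at h5
    refine Eq.trans h5 ?_
    rw [Pi.single_apply, Pi.single_apply]
    split_ifs
    · exact map_one (evalHom μ)
    · exact map_zero (evalHom μ)
  rw [dotProduct_sum, Finset.sum_eq_single i]
  · rw [dotProduct_smul, key i hi, Pi.single_eq_same, smul_eq_mul, mul_one]
  · intro j hj hji
    rw [dotProduct_smul, key j (Finset.mem_range.1 hj), Pi.single_eq_of_ne hji.symm, smul_zero]
  · intro h
    exact absurd (Finset.mem_range.2 hi) h

/-! ### Identifiable functions -/

/-- For a generic input and a generic initial state, the output determines the specialized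
input-output equation (`StateSpace.io_equation_unique`), hence the values of the functions in the
field generated by its coefficients. -/
lemma identifiable_of_mem_coeffField (ha : a.Monic)
    (hmin : ∀ f, S.toStateSpace.obs f = 0 ↔ a ∣ f) {h : ParamField l}
    (hh : h ∈ coeffField (m := 1) fun _ => S.ioPoly a) : S.Identifiable h := by
  obtain ⟨Q₁, hQ₁, hsep⟩ := exists_ratEval_eq_of_mem_adjoin hh
  obtain ⟨m, s, hdeg, hX, x, hx⟩ := StateSpace.exists_det_hankel_ne_zero ha hmin
  obtain ⟨Q₂, hQ₂, hhankel⟩ := S.exists_specialized_hankel_ne_zero hx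
  obtain ⟨U, hU, hgen⟩ := exists_isNonemptyZariskiOpenFn κ (2 * n)
  have hcard : m + s ≤ n := by
    have h1 : a ∣ S.toStateSpace.A.charpoly := (hmin _).1 S.toStateSpace.obs_charpoly
    have h2 := natDegree_le_of_dvd h1 (Matrix.charpoly_monic _).ne_zero
    rwa [Matrix.charpoly_natDegree_eq_dim, Fintype.card_fin, hdeg] at h2
  let Q := Q₂ * MvPolynomial.rename Sum.inr Q₁
  have hQ : Q ≠ 0 := mul_ne_zero hQ₂ (by
    rwa [Ne, map_eq_zero_iff _ (MvPolynomial.rename_injective _ Sum.inr_injective)])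
  refine ⟨{z | MvPolynomial.eval (Sum.elim z.1 z.2) Q ≠ 0}, ⟨?_, Q, rfl⟩, U, hU, ?_⟩
  · obtain ⟨z, hz⟩ := exists_eval_ne_zero hQ
    exact ⟨(z ∘ Sum.inl, z ∘ Sum.inr), by rwa [Set.mem_ofPred_eq, Sum.elim_comp_inl_inr]⟩
  intro x₀ μ u hΘ hu hΩ
  simp only [Q, Set.mem_ofPred_eq, map_mul, mul_ne_zero_iff, MvPolynomial.eval_rename,
    Sum.elim_comp_inr] at hΘ
  obtain ⟨b, hb, hbdeg, hb0, hbc, hbr⟩ := S.exists_specialized_annihilator ha hmin hΩ.1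
  rw [Set.encard_eq_one]
  refine ⟨ratEval h μ, Set.eq_singleton_iff_unique_mem.2 ⟨?_, ?_⟩⟩
  · exact ⟨x₀, μ, hΩ, S.exists_common_output_iff.2 rfl, rfl⟩
  · rintro _ ⟨x₁, ν, hν, hY, rfl⟩
    obtain ⟨c, hc, hcdeg, hc0, hcc, hcr⟩ := S.exists_specialized_annihilator ha hmin hν.1
    have hXd : ∀ d : ℂ[X], ∀ ρ, (∀ i, DefinedAt (a.coeff i) ρ ∧
        ratEval (a.coeff i) ρ = d.coeff i) → X ^ m ∣ d := by
      intro d ρ hd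
      rw [X_pow_dvd_iff] at hX ⊢
      intro i hi
      rw [← (hd i).2, hX i hi, ratEval_zero]
    have h1 := StateSpace.io_equation_unique (𝒮 := S.specialize μ) (𝒯 := S.specialize ν) hb hc
      (hbdeg.trans hdeg) (hcdeg.trans hdeg) (by rwa [Fintype.card_fin]) (hXd b μ hbc)
      (hXd c ν hcc) hb0 hc0 (by rw [Fintype.card_fin]; exact hgen u hu)
      (hhankel x₀ μ hΩ.1 hΘ.1) (S.exists_common_output_iff.1 hY)
    have h2 := S.coeff_ioPoly_agree_iff hbc hbr hcc hcr
    refine (hsep μ ν hΘ.2 hΩ.2 hν.2 ?_).symm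
    rintro _ ⟨j, e, rfl⟩
    exact ⟨(h2.1 e).1, (h2.1 e).2, h2.2.2 h1 e⟩

/-- A function outside the field of the coefficients takes different values at two generic
parameter values with the same specialized input-output equation. These have a common output for
every input, by `StateSpace.exists_outSeq_eq`. -/
lemma mem_coeffField_of_identifiable (ha : a.Monic)
    (hmin : ∀ f, S.toStateSpace.obs f = 0 ↔ a ∣ f) {h : ParamField l}
    (hh : S.Identifiable h) : h ∈ coeffField (m := 1) fun _ => S.ioPoly a := by
  by_contra hne
  obtain ⟨Θ, ⟨⟨⟨x₀, μ₀⟩, hx₀⟩, P, rfl⟩, U, ⟨⟨u, hu⟩, -⟩, hone⟩ := hh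
  obtain ⟨G₁, hG₁, hΩ⟩ := S.exists_mem_Ω
  obtain ⟨G₂, hG₂, hobs⟩ := S.exists_observable ha hmin
  let G₃ : MvPolynomial (Fin l) ℂ :=
    MvPolynomial.aeval (Sum.elim (fun i => MvPolynomial.C (x₀ i)) MvPolynomial.X) P
  have hG₃ : ∀ μ, MvPolynomial.eval μ G₃ = MvPolynomial.eval (Sum.elim x₀ μ) P :=
    eval_aeval_sum_elim x₀ P
  have hG : G₁ * G₂ * G₃ ≠ 0 := by
    refine mul_ne_zero (mul_ne_zero hG₁ hG₂) fun h0 => hx₀ ?_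
    rw [← hG₃, h0, map_zero]
  obtain ⟨μ, ν, hμ, hν, hdμ, hdν, hsep, hagree⟩ := exists_points_of_notMem_adjoin hne hG
  simp only [map_mul, mul_ne_zero_iff, hG₃] at hμ hν
  have hμΩ := hΩ μ hμ.1.1
  have hνΩ := hΩ ν hν.1.1
  obtain ⟨b, hb, hbdeg, hb0, hbc, hbr⟩ := S.exists_specialized_annihilator ha hmin hμΩ
  obtain ⟨c, hc, hcdeg, hc0, hcc, hcr⟩ := S.exists_specialized_annihilator ha hmin hνΩ
  have h2 := S.coeff_ioPoly_agree_iff hbc hbr hcc hcr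
  obtain ⟨rfl, hsome, hnone⟩ := h2.2.1 fun e => hagree _ ⟨0, e, rfl⟩ (h2.1 e).1 (h2.1 e).2
  obtain ⟨x₁, hx₁⟩ := StateSpace.exists_outSeq_eq hb hb0 hc0 hsome hnone
    (by rw [hbdeg]; exact hobs ν hνΩ hν.1.2) (fun k => jet (u k)) x₀
  have h3 := hone x₀ μ u hμ.2 hu ⟨hμΩ, hdμ⟩
  obtain ⟨z, hz⟩ := Set.encard_eq_one.1 h3
  have h4 : ratEval h μ ∈ S.outputFiber h x₀ μ u :=
    ⟨x₀, μ, ⟨hμΩ, hdμ⟩, S.exists_common_output_iff.2 rfl, rfl⟩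
  have h5 : ratEval h ν ∈ S.outputFiber h x₀ μ u :=
    ⟨x₁, ν, ⟨hνΩ, hdν⟩, S.exists_common_output_iff.2 hx₁.symm, rfl⟩
  rw [hz, Set.mem_singleton_iff] at h4 h5
  exact hsep (h4.trans h5.symm)

end LinearSystem
end LinearIdent

end

/-- For a linear system with exactly one output, a rational function of the parameters is
identifiable iff it is IO-identifiable; and the set of identifiable functions is the field
generated over `ℂ` by the coefficients of the input-output equation. -/
theorem theorem4p2 {n κ l : ℕ} (S : LinearIdent.LinearSystem n 1 κ l) :
    (∀ h : LinearIdent.ParamField l, S.Identifiable h ↔ S.IOIdentifiable h) ∧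
    ∀ p, S.IsFullIOSet p →
      {h : LinearIdent.ParamField l | S.Identifiable h} = (LinearIdent.coeffField p : Set _) := by
  obtain ⟨a, ha, hmin⟩ := S.toStateSpace.exists_monic_annihilator
  have key : ∀ h, S.Identifiable h ↔ h ∈ LinearIdent.coeffField (m := 1) fun _ => S.ioPoly a :=
    fun h => ⟨S.mem_coeffField_of_identifiable ha hmin, S.identifiable_of_mem_coeffField ha hmin⟩
  refine ⟨fun h => (key h).trans ⟨fun hh => ⟨_, (S.isFullIOSet_iff ha hmin).2 rfl, hh⟩, ?_⟩,
    fun p hp => ?_⟩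
  · rintro ⟨p, hp, hh⟩
    rwa [(S.isFullIOSet_iff ha hmin).1 hp] at hh
  · rw [(S.isFullIOSet_iff ha hmin).1 hp]
    ext h
    exact key h
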